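/- Let $d\ge 3$, $n\ge 0$ and $\Lambda=V_n=\{i\in\mathbb Z^d: |i|_\infty\le n\}$. Let $E$ be the set of nearest neighbour edges of $\mathbb Z^d$ contained in $\Lambda$, $N=|\Lambda|$, $i_0=0$, and let $(a_e)_{e\in E}$ be positive weights. Put $\mathcal H_0=\{v\in\mathbb R^\Lambda: v_0=0\}$ and, for $u,s\in\mathcal H_0$ and $x,y\in\Lambda$, $$B_{xy}=\cosh(u_x-u_y)+\tfrac12 e^{u_x+u_y}(s_x-s_y)^2 .$$ For an edge $e=\{i,j\}\in E$ write $B_e=B_{ij}$. Let $(W,U,S)$ have the density $$\frac{1}{(2\pi)^{N-1}}\,e^{-\sum_{j\in\Lambda}u_j}\,e^{-\sum_{e\in E}w_e(B_e-1)}\,D[m(w,u)]\prod_{e\in E}\frac{e^{-w_e}w_e^{a_e-1}}{\Gamma(a_e)}$$ with respect to $\prod_{e\in E}dw_e\prod_{k\ne 0}du_k\,ds_k$ on $(0,\infty)^E\times\mathcal H_0\times\mathcal H_0$. Here $m(w,u)$ is the $N\times N$ matrix with entries $-w_{ij}e^{u_i+u_j}$ for $i\ne j$ and $\sum_k w_{ik}e^{u_i+u_k}$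 for $i=j$ (with $w_{ij}=0$ if $\{i,j\}\notin E$), and $D[m(w,u)]$ is its diagonal minor obtained by deleting the row and the column of $0$. Let $\langle\cdot\rangle$ denote integration with respect to the resulting marginal law of $(U,S)$. For $x,y\in\Lambda$ let $D_{xy}=D_{xy}(u,s)$ be the effective resistance between $x$ and $y$ in the graph $(\Lambda,E)$ for the conductances $$c^{xy}_{ij}=\frac{a_{ij}\,e^{u_i+u_j-u_x-u_y}\,B_{xy}}{B_{ij}},\qquad \{i,j\}\in E,$$ that is, the infimum of $\frac12\sum_{(i,j):\,i\sim j}\theta(i,j)^2/c^{xy}_{ij}$ over all unit flows $\theta$ from $x$ to $y$, i.e. antisymmetric functions $\theta$ on the directed edges with $\sum_{j\sim v}\theta(v,j)=\mathbf 1_{v=x}-\mathbf 1_{v=y}$ for all $v\in\Lambda$. Then for every real $m$ with $m\le a_e/4$ for all $e\in E$ (that is, $m\le \frac14\min_{e\in E} a_e$ when $E\neq\emptyset$), and for all $x,y\in\Lambda$ (not necessarily neighbours), the function $B_{xy}^m(1-mD_{xy})$ is integrable and $$\langle B_{xy}^m(1-mD_{xy})\rangle=1 .$$ -/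

import Mathlib

open MeasureTheory

namespace Ward

noncomputable section

/-! ### The lattice boxes -/

/-- The nearest neighbour graph on `ℤ^d`. -/
def lattice (d : ℕ) : SimpleGraph (Fin d → ℤ) where
  Adj i j := ∑ k, |i k - j k| = 1
  symm := ⟨fun i j h => by simpa only [abs_sub_comm] using h⟩
  loopless := ⟨fun i h => by simp at h⟩

instance (d : ℕ) : DecidableRel (lattice d).Adj :=
  fun i j => inferInstanceAs (Decidable (∑ k, |i k - j k| = 1))

/-- The box `V_n = {i ∈ ℤ^d : |i|_∞ ≤ n}`. -/
abbrev Box (d n : ℕ) : Type :=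
  ↥(Finset.Icc (fun _ : Fin d => -(n : ℤ)) (fun _ => (n : ℤ)))

/-- The graph `(V_n, E_n)`: all edges of `ℤ^d` with both ends in the box. -/
abbrev boxGraph (d n : ℕ) : SimpleGraph (Box d n) :=
  (lattice d).comap Subtype.val

/-- The vertex `0` of the box. -/
def origin (d n : ℕ) : Box d n :=
  ⟨0, Finset.mem_Icc.2 ⟨fun _ => by simp, fun _ => by simp⟩⟩

/-! ### The measure, on a finite graph `G` with a marked vertex `o` -/

variable {V : Type*}

/-- The value on the pair `i, j` of a family indexed by the edges; it is `0` off the edges. -/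
def pairWeight (G : SimpleGraph V) [DecidableRel G.Adj] (w : G.edgeSet → ℝ) (i j : V) : ℝ :=
  if h : G.Adj i j then w ⟨s(i, j), h⟩ else 0

/-- `B_{xy} = cosh (u_x - u_y) + e^{u_x + u_y} (s_x - s_y)² / 2`. -/
def B (u s : V → ℝ) (x y : V) : ℝ :=
  Real.cosh (u x - u y) + Real.exp (u x + u y) * (s x - s y) ^ 2 / 2

theorem B_comm (u s : V → ℝ) (x y : V) : B u s x y = B u s y x := by
  unfold B
  rw [← Real.cosh_neg, neg_sub, add_comm (u x), ← neg_sub (s y), neg_sq]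

/-- `B` as a function of an unordered pair. -/
def edgeB (u s : V → ℝ) (e : Sym2 V) : ℝ :=
  Sym2.lift ⟨B u s, B_comm u s⟩ e

/-- `ℋ₀ = {v ∈ ℝ^V : v_o = 0}`, in the coordinates `v_k`, `k ≠ o`. Its Lebesgue measure is
`∏_{k ≠ o} dv_k`. -/
abbrev H0 (o : V) : Type _ := {k : V // k ≠ o} → ℝ

variable [DecidableEq V]

/-- The element of `ℝ^V` with the given coordinates off `o` and the value `0` at `o`. -/
def H0.toFun {o : V} (v : H0 o) (k : V) : ℝ :=
  if h : k = o then 0 else v ⟨k, h⟩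

variable [Fintype V]

/-- The matrix with entries `-c_{ij}` for `i ≠ j` and `∑_k c_{ik}` on the diagonal, for
conductances with `c_{ii} = 0`. -/
def laplacian (c : V → V → ℝ) : Matrix V V ℝ :=
  Matrix.of fun i j => if i = j then ∑ k, c i k else -c i j

/-- The diagonal minor: the determinant after the row and the column of `o` are deleted. -/
def diagMinor (M : Matrix V V ℝ) (o : V) : ℝ :=
  (M.submatrix (Subtype.val : {k : V // k ≠ o} → V) Subtype.val).det

variable (G : SimpleGraph V) [DecidableRel G.Adj]

/-- The density of `(W, U, S)` at a point `(w, u, s)` with all `w_e > 0`. -/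
def jointDensity (o : V) (a w : G.edgeSet → ℝ) (u s : V → ℝ) : ℝ :=
  1 / (2 * Real.pi) ^ (Fintype.card V - 1) * Real.exp (-∑ j, u j) *
    Real.exp (-∑ e : G.edgeSet, w e * (edgeB u s e - 1)) *
    diagMinor (laplacian fun i j => pairWeight G w i j * Real.exp (u i + u j)) o *
    ∏ e : G.edgeSet, Real.exp (-w e) * w e ^ (a e - 1) / Real.Gamma (a e)

/-- The law of `(W, U, S)` on `(0,∞)^E × ℋ₀ × ℋ₀`. -/
def jointLaw (o : V) (a : G.edgeSet → ℝ) : Measure ((G.edgeSet → ℝ) × H0 o × H0 o) :=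
  (volume.restrict {p | ∀ e, 0 < p.1 e}).withDensity fun p =>
    ENNReal.ofReal (jointDensity G o a p.1 p.2.1.toFun p.2.2.toFun)

/-- The law of `(U, S)`, after integration over `W`. -/
def lawUS (o : V) (a : G.edgeSet → ℝ) : Measure (H0 o × H0 o) :=
  (jointLaw G o a).map Prod.snd

/-! ### The effective resistance -/

/-- `θ` is a unit flow from `x` to `y` along the edges of `G` (the zero-divergence flows if
`x = y`). -/
structure IsUnitFlow (x y : V) (θ : V → V → ℝ) : Prop where
  antisymm : ∀ i j, θ i j = -θ j i
  support : ∀ i j, ¬ G.Adj i j → θ i j = 0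
  divergence : ∀ v, ∑ j, θ v j = (if v = x then 1 else 0) - (if v = y then 1 else 0)

/-- The energy `(1/2) ∑ θ(i,j)² / c_{ij}`, the sum being over the directed edges. -/
def energy (c θ : V → V → ℝ) : ℝ :=
  1 / 2 * ∑ i, ∑ j, if G.Adj i j then θ i j ^ 2 / c i j else 0

/-- The effective resistance between `x` and `y` for conductances `c`: the least energy of a unit
flow from `x` to `y`. -/
def effResistance (c : V → V → ℝ) (x y : V) : ℝ :=
  sInf (energy G c '' {θ | IsUnitFlow G x y θ})

/-- The conductances `c^{xy}_{ij} = a_{ij} e^{u_i + u_j - u_x - u_y} B_{xy} / B_{ij}`. -/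
def cond (a : G.edgeSet → ℝ) (u s : V → ℝ) (x y i j : V) : ℝ :=
  pairWeight G a i j * Real.exp (u i + u j - u x - u y) * B u s x y / B u s i j

/-- `D_{xy}`, the effective resistance between `x` and `y` for the conductances `c^{xy}`. -/
def D (a : G.edgeSet → ℝ) (u s : V → ℝ) (x y : V) : ℝ :=
  effResistance G (cond G a u s x y) x y

end

end Ward

namespace Ward

noncomputable section

set_option linter.unusedSectionVars false

/-! The identity says that a probability measure keeps total mass one when an edge is added to the
graph. For every connected finite multigraph and all positive `a`, the law of (U,S) has mass one
(`lintegral_marginalDensity`). Add an edge of weight t > 0 between x and y. The product of the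
B_e^{-a_e} gains a factor B_xy^{-t}, and the Laplacian gains a rank-one term, so by the matrix
determinant lemma its determinant gains the factor 1 + t D_xy (`marginalDensity_option`). Mass one
for the enlarged graph is the claim for m = -t < 0. Multigraphs are needed because x and y may
already be joined, or may coincide.

Mass one comes from two facts. At fixed weights w the integral over (u,s) does not depend on w
(`lintegral_fixed_weights`): the integral over s is Gaussian and leaves the square root of the
determinant. The integral over u becomes, after a change of variables, the normalisation of the
random Schrödinger potential (`lintegral_potentialDensity`), computed by eliminating one vertex at a
time. On the other hand, given (u,s) the weights are integrated against Gamma densities of rates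
B_e. The determinant is affine in each weight, so its average is its value at the means a_e / B_e
(`lintegral_multiaffine_gamma`).

For m ≥ 0 the identity is continued analytically. Along a path from x to y, B_xy is at most a
constant times the product of the B_e, so B_xy^m (1 + D_xy) times the density is dominated by a
multiple of another density of the same family with smaller weights (`exists_marginalDensity_le`).
Hence it is integrable for every m below all the a_e. Both terms of the identity are then built from
moment generating functions of log B_xy, analytic on that half-line, and they agree with 1 for m <
0. Since a_e > 0, the bound m ≤ a_e / 4 lies inside. -/

/-! ### One-dimensional integrals of inverse Gaussian type -/

theorem lintegral_exp_neg_sq_div_two :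
    ∫⁻ t : ℝ, ENNReal.ofReal (Real.exp (-t ^ 2 / 2)) = ENNReal.ofReal (√(2 * Real.pi)) := by
  have h := integral_gaussian (1 / 2)
  have hi := integrable_exp_neg_mul_sq (b := 1 / 2) (by norm_num)
  have h2 : ∀ t : ℝ, -t ^ 2 / 2 = -(1 / 2) * t ^ 2 := fun t => by ring
  simp only [h2]
  rw [← ofReal_integral_eq_lintegral_ofReal hi (ae_of_all _ fun _ => (Real.exp_pos _).le), h]
  congr 2
  field_simp

/-- Substitute t = 2√c sinh(v/2): since cosh v = 1 + 2 sinh²(v/2), the integrand becomes e^{-c}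
e^{-t²/2} dt. -/
theorem lintegral_cosh_half_mul_exp_neg {c : ℝ} (hc : 0 < c) :
    ∫⁻ v : ℝ, ENNReal.ofReal (√c * Real.cosh (v / 2) * Real.exp (-c * Real.cosh v)) =
      ENNReal.ofReal (√(2 * Real.pi) * Real.exp (-c)) := by
  have hsc : 0 < √c := Real.sqrt_pos.2 hc
  have hd : ∀ v : ℝ, HasDerivAt (fun v => 2 * √c * Real.sinh (v / 2)) (√c * Real.cosh (v / 2)) v := by
    intro v
    have h := ((Real.hasDerivAt_sinh (v / 2)).comp v ((hasDerivAt_id v).div_const 2)).const_mul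
      (2 * √c)
    exact h.congr_deriv (by ring)
  have hinj : Function.Injective fun v => 2 * √c * Real.sinh (v / 2) := by
    intro a b hab
    have := mul_left_cancel₀ (by positivity) hab
    have := Real.sinh_injective this
    linarith
  have hsurj : Function.Surjective fun v => 2 * √c * Real.sinh (v / 2) := by
    intro t
    obtain ⟨r, hr⟩ := Real.sinh_surjective (t / (2 * √c))
    refine ⟨2 * r, ?_⟩
    simp only [mul_div_cancel_left₀ r (two_ne_zero), hr]
    field_simp
  have key := lintegral_image_eq_lintegral_abs_deriv_mul MeasurableSet.univ
    (fun v _ => (hd v).hasDerivWithinAt) hinj.injOn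
    (fun t => ENNReal.ofReal (Real.exp (-t ^ 2 / 2)) * ENNReal.ofReal (Real.exp (-c)))
  rw [Set.image_univ, hsurj.range_eq, Measure.restrict_univ,
    lintegral_mul_const' _ _ ENNReal.ofReal_ne_top, lintegral_exp_neg_sq_div_two,
    ← ENNReal.ofReal_mul (by positivity)] at key
  rw [key]
  refine lintegral_congr fun v => ?_
  have hch : 0 < Real.cosh (v / 2) := Real.cosh_pos _
  rw [abs_of_pos (by positivity), ← ENNReal.ofReal_mul (Real.exp_pos _).le,
    ← ENNReal.ofReal_mul (by positivity), ← Real.exp_add]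
  have h1 : Real.cosh v = 1 + 2 * Real.sinh (v / 2) ^ 2 := by
    have h := Real.cosh_two_mul (v / 2)
    rw [Real.cosh_sq, mul_div_cancel₀ v (two_ne_zero)] at h
    linarith
  congr 3
  rw [h1, mul_pow, mul_pow, Real.sq_sqrt hc.le]
  ring

/-- With y = c e^v the integrand is √c e^{v/2} e^{-c cosh v}, and symmetrising in v replaces e^{v/2}
by cosh(v/2). The substitution degenerates at c = 0, where the integral is Γ(1/2) up to scaling. -/
theorem lintegral_inv_sqrt_mul_exp {c : ℝ} (hc : 0 ≤ c) :
    ∫⁻ y in Set.Ioi (0 : ℝ), ENNReal.ofReal (Real.exp (-y / 2 - c ^ 2 / (2 * y)) / √y) =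
      ENNReal.ofReal (√(2 * Real.pi) * Real.exp (-c)) := by
  rcases hc.eq_or_lt with rfl | hc
  · have h := Real.integral_rpow_mul_exp_neg_mul_Ioi (a := 1 / 2) (r := 1 / 2) (by norm_num)
      (by norm_num)
    have hi := Real.GammaIntegral_convergent (s := 1 / 2) (by norm_num)
    have hpos : (0 : ℝ) ≤ √(2 * Real.pi) := by positivity
    have hval : ∫ y in Set.Ioi (0 : ℝ), Real.exp (-y / 2 - 0 ^ 2 / (2 * y)) / √y = √(2 * Real.pi) := by
      have e : √(2 * Real.pi) = (1 / (1 / 2) : ℝ) ^ (1 / 2 : ℝ) * Real.Gamma (1 / 2) := by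
        rw [Real.Gamma_one_half_eq, Real.sqrt_mul (by norm_num), Real.sqrt_eq_rpow]
        norm_num
      rw [e, ← h]
      refine setIntegral_congr_fun measurableSet_Ioi fun y hy => ?_
      rw [Real.sqrt_eq_rpow, div_eq_mul_inv, ← Real.rpow_neg (le_of_lt hy), mul_comm]
      congr 2 <;> norm_num
      ring
    have hint : IntegrableOn (fun y : ℝ => Real.exp (-y / 2 - 0 ^ 2 / (2 * y)) / √y)
        (Set.Ioi 0) := by
      -- A non-integrable function has Bochner integral 0, so the nonzero value just found forces
      -- integrability.
      by_contra hn
      rw [integral_undef hn] at hval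
      have : (0 : ℝ) < √(2 * Real.pi) := by positivity
      exact this.ne hval
    rw [← ofReal_integral_eq_lintegral_ofReal hint (ae_of_all _ fun _ => by positivity), hval]
    simp
  · have hd : ∀ v : ℝ, HasDerivAt (fun v => c * Real.exp v) (c * Real.exp v) v := fun v =>
      (Real.hasDerivAt_exp v).const_mul c
    have hinj : Function.Injective fun v => c * Real.exp v := fun a b hab =>
      Real.exp_injective (mul_left_cancel₀ hc.ne' hab)
    have himg : Set.range (fun v => c * Real.exp v) = Set.Ioi 0 := by
      ext y
      refine ⟨?_, fun hy => ⟨Real.log (y / c), ?_⟩⟩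
      · rintro ⟨v, rfl⟩
        exact mul_pos hc (Real.exp_pos v)
      · simp only
        rw [Real.exp_log (div_pos hy hc)]
        field_simp
    have key := lintegral_image_eq_lintegral_abs_deriv_mul MeasurableSet.univ
      (fun v _ => (hd v).hasDerivWithinAt) hinj.injOn
      (fun y => ENNReal.ofReal (Real.exp (-y / 2 - c ^ 2 / (2 * y)) / √y))
    rw [Set.image_univ, himg, Measure.restrict_univ] at key
    set f : ℝ → ENNReal := fun v =>
      ENNReal.ofReal (√c * Real.exp (v / 2) * Real.exp (-c * Real.cosh v)) with hf
    have h1 : ∫⁻ y in Set.Ioi (0 : ℝ), ENNReal.ofReal (Real.exp (-y / 2 - c ^ 2 / (2 * y)) / √y) =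
        ∫⁻ v, f v := by
      rw [key]
      refine lintegral_congr fun v => ?_
      rw [abs_of_pos (mul_pos hc (Real.exp_pos v)), ← ENNReal.ofReal_mul (by positivity)]
      congr 1
      have e1 : √(c * Real.exp v) = √c * Real.exp (v / 2) := by
        rw [Real.sqrt_mul hc.le, Real.exp_half]
      have e2 : c * Real.exp v = (√c * Real.exp (v / 2)) * (√c * Real.exp (v / 2)) := by
        rw [← e1, Real.mul_self_sqrt (by positivity)]
      have e3 : -(c * Real.exp v) / 2 - c ^ 2 / (2 * (c * Real.exp v)) = -c * Real.cosh v := by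
        rw [Real.cosh_eq, Real.exp_neg]
        field_simp
        ring
      rw [e1, e3, e2]
      have : √c * Real.exp (v / 2) ≠ 0 := (mul_pos (Real.sqrt_pos.2 hc) (Real.exp_pos _)).ne'
      field_simp
    rw [h1, ← lintegral_cosh_half_mul_exp_neg hc]
    have h2 : ∫⁻ v, f (-v) = ∫⁻ v, f v := lintegral_neg_eq_self f
    have hmeas : Measurable f := by fun_prop
    have h3 : (∫⁻ v, f v) + ∫⁻ v, f v = 2 * ∫⁻ v : ℝ, ENNReal.ofReal
        (√c * Real.cosh (v / 2) * Real.exp (-c * Real.cosh v)) := by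
      conv_lhs => rw [← h2]
      conv_lhs => rw [h2]
      nth_rewrite 2 [← h2]
      rw [← lintegral_add_left hmeas, ← lintegral_const_mul' _ _ (by simp)]
      refine lintegral_congr fun v => ?_
      rw [hf]
      simp only
      rw [← ENNReal.ofReal_add (by positivity) (by positivity), Real.cosh_neg, Real.cosh_eq (v / 2),
        show (2 : ENNReal) = ENNReal.ofReal 2 by simp, ← ENNReal.ofReal_mul (by norm_num), neg_div]
      congr 1
      ring
    rw [← two_mul] at h3
    exact (ENNReal.mul_right_inj (by simp) (by simp)).1 h3

open Matrix

/-! ### The random Schrödinger potential and its normalisation -/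

section Beta

variable {α β : Type*} [Fintype α] [DecidableEq α] [Fintype β] [DecidableEq β]

/-- Write x = r - n with positive part r and negative part n. These have disjoint supports, so n·Hr
≤ 0 by the sign of the off-diagonal entries. With n·Hx ≥ 0 this gives n·Hn ≤ 0, hence n = 0. -/
theorem nonneg_of_mulVec_nonneg {H : Matrix α α ℝ} (hH : H.PosDef)
    (hoff : ∀ i j, i ≠ j → H i j ≤ 0) {x : α → ℝ} (hx : ∀ i, 0 ≤ (H *ᵥ x) i) (i : α) :
    0 ≤ x i := by
  set n : α → ℝ := fun i => max (-x i) 0 with hn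
  set r : α → ℝ := fun i => max (x i) 0 with hr
  have hxr : x = r - n := by
    funext i
    simp only [hn, hr, Pi.sub_apply]
    rcases le_total 0 (x i) with h | h
    · rw [max_eq_left h, max_eq_right (by linarith)]; ring
    · rw [max_eq_right h, max_eq_left (by linarith)]; ring
  have h1 : 0 ≤ n ⬝ᵥ H *ᵥ x :=
    Finset.sum_nonneg fun i _ => mul_nonneg (le_max_right _ _) (hx i)
  have h2 : n ⬝ᵥ H *ᵥ r ≤ 0 := by
    refine Finset.sum_nonpos fun i _ => ?_
    rw [mulVec, dotProduct, Finset.mul_sum]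
    refine Finset.sum_nonpos fun j _ => ?_
    by_cases hij : i = j
    · subst hij
      have : n i * r i = 0 := by
        simp only [hn, hr]
        rcases le_total 0 (x i) with h | h
        · rw [max_eq_right (by linarith : -x i ≤ 0)]; ring
        · rw [max_eq_right h]; ring
      calc n i * (H i i * r i) = H i i * (n i * r i) := by ring
        _ ≤ 0 := by rw [this, mul_zero]
    · have h3 : 0 ≤ n i * r j := mul_nonneg (le_max_right _ _) (le_max_right _ _)
      nlinarith [mul_nonneg h3 (neg_nonneg.2 (hoff i j hij))]
  have h3 : n ⬝ᵥ H *ᵥ n ≤ 0 := by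
    rw [hxr, mulVec_sub, dotProduct_sub] at h1
    linarith
  have h4 : n = 0 := by
    by_contra hne
    have := hH.dotProduct_mulVec_pos hne
    simp only [star_trivial] at this
    linarith
  have h5 : max (-x i) 0 = 0 := congrFun h4 i
  have := max_eq_right_iff.1 h5
  linarith

/-- The matrix `A` with one row and one column added. -/
def bordered (A : Matrix α α ℝ) (v : α → ℝ) (d : ℝ) : Matrix (α ⊕ Unit) (α ⊕ Unit) ℝ :=
  fromBlocks A (-replicateCol Unit v) (-replicateRow Unit v) (of fun _ _ => d)

theorem replicateRow_mul_mul_replicateCol (A : Matrix α α ℝ) (v w : α → ℝ) :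
    replicateRow Unit v * A * replicateCol Unit w = of fun _ _ => v ⬝ᵥ A *ᵥ w := by
  ext i j
  rw [Matrix.mul_assoc, mul_apply]
  rfl

theorem det_bordered {A : Matrix α α ℝ} (hA : A.PosDef) (v : α → ℝ) (d : ℝ) :
    (bordered A v d).det = A.det * (d - v ⬝ᵥ A⁻¹ *ᵥ v) := by
  have := hA.isUnit.invertible
  rw [bordered, det_fromBlocks₁₁, invOf_eq_nonsing_inv, Matrix.neg_mul, Matrix.neg_mul,
    Matrix.mul_neg, neg_neg, replicateRow_mul_mul_replicateCol]
  congr 1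
  rw [det_unique]
  rfl

theorem posDef_bordered_iff {A : Matrix α α ℝ} (hA : A.PosDef) (v : α → ℝ) (d : ℝ) :
    (bordered A v d).PosDef ↔ 0 < d - v ⬝ᵥ A⁻¹ *ᵥ v := by
  have := hA.isUnit.invertible
  have h := PosDef.fromBlocks₁₁ (-replicateCol Unit v) (of fun _ _ : Unit => d) hA
  have hB : (-replicateCol Unit v)ᴴ = -replicateRow Unit v := by
    ext; simp
  rw [hB] at h
  have h2 : (of fun _ _ : Unit => d) - -replicateRow Unit v * A⁻¹ * -replicateCol Unit v =
      diagonal fun _ => d - v ⬝ᵥ A⁻¹ *ᵥ v := by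
    rw [Matrix.neg_mul, Matrix.neg_mul, Matrix.mul_neg, neg_neg, replicateRow_mul_mul_replicateCol]
    ext i j
    simp [diagonal]
  rw [h2, posSemidef_diagonal_iff] at h
  constructor
  · intro hp
    have h3 := hp.det_pos
    rw [det_bordered hA] at h3
    exact (pos_iff_pos_of_mul_pos h3).1 hA.det_pos
  · intro hp
    refine (h.2 fun _ => hp.le).posDef_iff_det_ne_zero.2 ?_
    change (bordered A v d).det ≠ 0
    rw [det_bordered hA]
    exact (mul_pos hA.det_pos hp).ne'

theorem inv_mulVec_eq {A : Matrix α α ℝ} (hA : IsUnit A) {x y : α → ℝ} (h : A *ᵥ x = y) :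
    A⁻¹ *ᵥ y = x := by
  rw [← h, mulVec_mulVec, nonsing_inv_mul _ ((isUnit_iff_isUnit_det A).1 hA), one_mulVec]

theorem mulVec_inv_mulVec {A : Matrix α α ℝ} (hA : IsUnit A) (y : α → ℝ) :
    A *ᵥ (A⁻¹ *ᵥ y) = y := by
  rw [mulVec_mulVec, mul_nonsing_inv _ ((isUnit_iff_isUnit_det A).1 hA), one_mulVec]

theorem dotProduct_mulVec_comm {A : Matrix α α ℝ} (hA : A.IsSymm) (x y : α → ℝ) :
    x ⬝ᵥ A *ᵥ y = y ⬝ᵥ A *ᵥ x := by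
  rw [dotProduct_mulVec, ← mulVec_transpose, hA.eq, dotProduct_comm]

theorem posDef_isSymm {A : Matrix α α ℝ} (hA : A.PosDef) : A.IsSymm := by
  have := hA.isHermitian
  rwa [IsHermitian, conjTranspose_eq_transpose_of_trivial] at this

/-- Block elimination: the last coordinate z of the solution is the reduced right-hand side divided
by the Schur complement, and the others are A⁻¹(x + z v). -/
theorem dotProduct_inv_bordered {A : Matrix α α ℝ} (hA : A.PosDef) (v : α → ℝ) (d : ℝ)
    (hd : 0 < d - v ⬝ᵥ A⁻¹ *ᵥ v) (x : α → ℝ) (t : ℝ) :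
    Sum.elim x (fun _ => t) ⬝ᵥ (bordered A v d)⁻¹ *ᵥ Sum.elim x (fun _ => t) =
      x ⬝ᵥ A⁻¹ *ᵥ x + (t + v ⬝ᵥ A⁻¹ *ᵥ x) ^ 2 / (d - v ⬝ᵥ A⁻¹ *ᵥ v) := by
  set y := d - v ⬝ᵥ A⁻¹ *ᵥ v with hy
  set z := (t + v ⬝ᵥ A⁻¹ *ᵥ x) / y with hz
  have hsymm : x ⬝ᵥ A⁻¹ *ᵥ v = v ⬝ᵥ A⁻¹ *ᵥ x := dotProduct_mulVec_comm (posDef_isSymm hA.inv) _ _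
  have hsol : bordered A v d *ᵥ Sum.elim (A⁻¹ *ᵥ x + z • A⁻¹ *ᵥ v) (fun _ => z) =
      Sum.elim x fun _ => t := by
    rw [bordered, fromBlocks_mulVec]
    congr 1
    · have h1 : (-replicateCol Unit v) *ᵥ (fun _ => z) = -(z • v) := by
        ext i
        simp [mulVec, dotProduct, mul_comm]
      rw [Sum.elim_comp_inl, Sum.elim_comp_inr, h1, mulVec_add, mulVec_smul,
        mulVec_inv_mulVec hA.isUnit, mulVec_inv_mulVec hA.isUnit]
      simp
    · ext i
      have h2 : ((-replicateRow Unit v) *ᵥ (A⁻¹ *ᵥ x + z • A⁻¹ *ᵥ v)) i =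
          -(v ⬝ᵥ (A⁻¹ *ᵥ x + z • A⁻¹ *ᵥ v)) := by
        simp [mulVec, dotProduct]
      rw [Sum.elim_comp_inl, Sum.elim_comp_inr, Pi.add_apply, h2, dotProduct_add, dotProduct_smul]
      have h3 : z * y = t + v ⬝ᵥ A⁻¹ *ᵥ x := div_mul_cancel₀ _ hd.ne'
      simp only [mulVec, dotProduct, smul_eq_mul, Finset.univ_unique, Finset.sum_singleton,
        of_apply] at h3 hy ⊢
      rw [hy] at h3
      linarith
  rw [inv_mulVec_eq ((posDef_bordered_iff hA v d).2 hd).isUnit hsol, sumElim_dotProduct_sumElim,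
    dotProduct_add, dotProduct_smul, hsymm]
  have h4 : (fun _ : Unit => t) ⬝ᵥ (fun _ => z) = t * z := by simp [dotProduct]
  rw [h4, smul_eq_mul, hz]
  ring

/-- The matrix `diag(b) - W`. -/
def schrodinger (W : Matrix α α ℝ) (b : α → ℝ) : Matrix α α ℝ := diagonal b - W

/-- The density of the random Schrödinger potential, without its normalisation. -/
def potentialDensity (W : Matrix α α ℝ) (η b : α → ℝ) : ℝ :=
  Real.exp (-(1 ⬝ᵥ schrodinger W b *ᵥ 1) / 2 - (η ⬝ᵥ (schrodinger W b)⁻¹ *ᵥ η) / 2 + η ⬝ᵥ 1) /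
    √(schrodinger W b).det

theorem schrodinger_isSymm {W : Matrix α α ℝ} (hW : W.IsSymm) (b : α → ℝ) :
    (schrodinger W b).IsSymm :=
  (isSymm_diagonal b).sub hW

theorem continuous_schrodinger (W : Matrix α α ℝ) : Continuous (schrodinger W) :=
  (Continuous.matrix_diagonal continuous_id).sub continuous_const

/-- The inverse is the adjugate, a polynomial, divided by the determinant; this formula also covers
singular matrices, with the convention 0⁻¹ = 0. -/
theorem measurable_dotProduct_inv_mulVec (W : Matrix α α ℝ) (η : α → ℝ) :
    Measurable fun b => η ⬝ᵥ (schrodinger W b)⁻¹ *ᵥ η := by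
  have hc := continuous_schrodinger W
  have h : (fun b => η ⬝ᵥ (schrodinger W b)⁻¹ *ᵥ η) = fun b =>
      (schrodinger W b).det⁻¹ * (η ⬝ᵥ (schrodinger W b).adjugate *ᵥ η) := by
    funext b
    rw [inv_def, Ring.inverse_eq_inv', smul_mulVec, dotProduct_smul, smul_eq_mul]
  rw [h]
  refine hc.matrix_det.measurable.inv.mul (Continuous.measurable ?_)
  exact Continuous.dotProduct continuous_const (hc.matrix_adjugate.matrix_mulVec continuous_const)

theorem measurable_potentialDensity (W : Matrix α α ℝ) (η : α → ℝ) :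
    Measurable (potentialDensity W η) := by
  have hc := continuous_schrodinger W
  have h1 : Measurable fun b => 1 ⬝ᵥ schrodinger W b *ᵥ (1 : α → ℝ) :=
    (Continuous.dotProduct continuous_const (hc.matrix_mulVec continuous_const)).measurable
  have h2 := measurable_dotProduct_inv_mulVec W η
  have h3 := hc.matrix_det.measurable
  unfold potentialDensity
  fun_prop

theorem measurableSet_posDef_schrodinger {W : Matrix α α ℝ} (hW : W.IsSymm) :
    MeasurableSet {b | (schrodinger W b).PosDef} := by
  have hc := continuous_schrodinger W
  have h : {b | (schrodinger W b).PosDef} =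
      (⋂ x : α → ℝ, {b | 0 ≤ x ⬝ᵥ schrodinger W b *ᵥ x}) ∩ {b | (schrodinger W b).det ≠ 0} := by
    ext b
    simp only [Set.mem_ofPred_eq, Set.mem_inter_iff, Set.mem_iInter]
    refine ⟨fun h => ⟨fun x => ?_, h.det_pos.ne'⟩, fun h => ?_⟩
    · have := h.posSemidef.dotProduct_mulVec_nonneg x
      simpa using this
    · refine (PosSemidef.posDef_iff_det_ne_zero ?_).2 h.2
      refine .of_dotProduct_mulVec_nonneg ?_ fun x => by simpa using h.1 x
      rw [IsHermitian, conjTranspose_eq_transpose_of_trivial]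
      exact schrodinger_isSymm hW b
  rw [h]
  refine MeasurableSet.inter (IsClosed.measurableSet ?_) ?_
  · exact isClosed_iInter fun x => isClosed_le continuous_const
      (Continuous.dotProduct continuous_const (hc.matrix_mulVec continuous_const))
  · exact (hc.matrix_det.measurable (measurableSet_singleton 0)).compl

theorem lintegral_sum_unit {F : (α ⊕ Unit → ℝ) → ENNReal} (hF : Measurable F) :
    ∫⁻ b, F b = ∫⁻ b : α → ℝ, ∫⁻ t : ℝ, F (Sum.elim b fun _ => t) := by
  have h1 := volume_measurePreserving_sumPiEquivProdPi_symm (fun _ : α ⊕ Unit => ℝ)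
  rw [← h1.lintegral_comp hF, Measure.volume_eq_prod,
    lintegral_prod (fun z => F ((MeasurableEquiv.sumPiEquivProdPi fun _ => ℝ).symm z))
      (hF.comp h1.measurable).aemeasurable]
  refine lintegral_congr fun b => ?_
  have h2 := (volume_preserving_funUnique Unit ℝ).symm
  rw [← h2.lintegral_comp_emb (MeasurableEquiv.measurableEmbedding _)]
  refine lintegral_congr fun t => congrArg F ?_
  funext i
  cases i <;> rfl

theorem schrodinger_sum (W : Matrix (α ⊕ Unit) (α ⊕ Unit) ℝ) (hW : W.IsSymm) (b : α → ℝ) (t : ℝ) :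
    schrodinger W (Sum.elim b fun _ => t) =
      bordered (schrodinger W.toBlocks₁₁ b) (fun i => W (Sum.inl i) (Sum.inr ()))
        (t - W (Sum.inr ()) (Sum.inr ())) := by
  ext i j
  rcases i with i | i <;> rcases j with j | j
  · simp [schrodinger, bordered, diagonal_apply, toBlocks₁₁]
  · simp [schrodinger, bordered]
  · simp [schrodinger, bordered, hW.apply]
  · simp [schrodinger, bordered]

theorem one_dotProduct_bordered (A : Matrix α α ℝ) (v : α → ℝ) (d : ℝ) :
    1 ⬝ᵥ bordered A v d *ᵥ 1 = 1 ⬝ᵥ A *ᵥ 1 - 2 * (v ⬝ᵥ 1) + d := by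
  simp [bordered, dotProduct, mulVec, Fintype.sum_sum_type, Finset.sum_add_distrib,
    Finset.sum_neg_distrib]
  ring

/-- Elimination of one vertex. In terms of its Schur complement y, positive definiteness is y > 0,
the determinant factors, and the density is that of the smaller matrix times e^c e^{-y/2 -
c²/(2y)}/√y. The y-integral is √(2π) e^{-c}, so c cancels. The edges to the lost vertex are absorbed
into the boundary weights η, which is why η must be general. -/
theorem lintegral_potentialDensity_border {W : Matrix (α ⊕ Unit) (α ⊕ Unit) ℝ} (hW : W.IsSymm)
    (hW0 : ∀ i j, 0 ≤ W i j) {η : α ⊕ Unit → ℝ} (hη : ∀ i, 0 ≤ η i) (b : α → ℝ)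
    (hb : (schrodinger W.toBlocks₁₁ b).PosDef) :
    ∫⁻ t : ℝ, Set.indicator {b | (schrodinger W b).PosDef}
        (fun b => ENNReal.ofReal (potentialDensity W η b)) (Sum.elim b fun _ => t) =
      ENNReal.ofReal (potentialDensity W.toBlocks₁₁
        (fun i => η (Sum.inl i) + W (Sum.inl i) (Sum.inr ())) b) *
        ENNReal.ofReal √(2 * Real.pi) := by
  set A := schrodinger W.toBlocks₁₁ b with hA
  set v : α → ℝ := fun i => W (Sum.inl i) (Sum.inr ()) with hv
  set x : α → ℝ := fun i => η (Sum.inl i) with hx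
  set c := η (Sum.inr ()) + v ⬝ᵥ A⁻¹ *ᵥ x with hc
  have hsol : ∀ i, 0 ≤ (A⁻¹ *ᵥ x) i := by
    refine nonneg_of_mulVec_nonneg hb (fun i j hij => ?_) fun i => ?_
    · simp [hA, schrodinger, diagonal_apply_ne _ hij, toBlocks₁₁, hW0]
    · rw [mulVec_inv_mulVec hb.isUnit]
      exact hη _
  -- The inverse Gaussian integral yields e^{-|c|}; the cancellation with e^c needs c ≥ 0, hence the
  -- positivity of A⁻¹x.
  have hc0 : 0 ≤ c := add_nonneg (hη _) (Finset.sum_nonneg fun i _ => mul_nonneg (hW0 _ _) (hsol i))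
  -- The translation t = y + k makes y the Schur complement.
  set k := W (Sum.inr ()) (Sum.inr ()) + v ⬝ᵥ A⁻¹ *ᵥ v with hk
  have hd : ∀ y : ℝ, schrodinger W (Sum.elim b fun _ => y + k) =
      bordered A v (y + v ⬝ᵥ A⁻¹ *ᵥ v) := by
    intro y
    rw [schrodinger_sum W hW, hk]
    congr 1
    ring
  have hη' : η = Sum.elim x fun _ => η (Sum.inr ()) := by
    funext i
    rcases i with i | i <;> rfl
  have hsymm : x ⬝ᵥ A⁻¹ *ᵥ v = v ⬝ᵥ A⁻¹ *ᵥ x := dotProduct_mulVec_comm (posDef_isSymm hb.inv) _ _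
  rw [← lintegral_add_right_eq_self _ k]
  have hpt : ∀ y : ℝ, Set.indicator {b | (schrodinger W b).PosDef}
        (fun b => ENNReal.ofReal (potentialDensity W η b)) (Sum.elim b fun _ => y + k) =
      Set.indicator (Set.Ioi 0) (fun y => ENNReal.ofReal (potentialDensity W.toBlocks₁₁
        (fun i => x i + v i) b * Real.exp c) *
        ENNReal.ofReal (Real.exp (-y / 2 - c ^ 2 / (2 * y)) / √y)) y := by
    intro y
    have hiff : (schrodinger W (Sum.elim b fun _ => y + k)).PosDef ↔ 0 < y := by
      rw [hd, posDef_bordered_iff hb, add_sub_cancel_right]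
    by_cases hy : 0 < y
    · rw [Set.indicator_of_mem (s := {b | (schrodinger W b).PosDef}) (Set.mem_ofPred_eq ▸ hiff.2 hy), Set.indicator_of_mem (Set.mem_Ioi.2 hy),
        ← ENNReal.ofReal_mul (by unfold potentialDensity; positivity)]
      congr 1
      have hy' : 0 < y + v ⬝ᵥ A⁻¹ *ᵥ v - v ⬝ᵥ A⁻¹ *ᵥ v := by rwa [add_sub_cancel_right]
      unfold potentialDensity
      rw [hd, one_dotProduct_bordered, det_bordered hb, ← hA]
      nth_rewrite 1 2 [hη']
      rw [dotProduct_inv_bordered hb v _ hy', add_sub_cancel_right, Real.sqrt_mul hb.det_pos.le,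
        div_mul_eq_mul_div, div_mul_div_comm, ← Real.exp_add, ← Real.exp_add]
      congr 2
      have e1 : η ⬝ᵥ 1 = x ⬝ᵥ 1 + η (Sum.inr ()) := by
        simp [dotProduct, hx]
      have e2 : (fun i => x i + v i) = x + v := rfl
      rw [e1, e2, mulVec_add, add_dotProduct, add_dotProduct, dotProduct_add, dotProduct_add, hsymm,
        hc]
      field_simp
      ring
    · rw [Set.indicator_of_notMem (s := {b | (schrodinger W b).PosDef})
        (fun h => hy (hiff.1 (by simpa using h))), Set.indicator_of_notMem (by simpa using hy)]
  simp_rw [hpt]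
  rw [lintegral_indicator measurableSet_Ioi, lintegral_const_mul' _ _ ENNReal.ofReal_ne_top,
    lintegral_inv_sqrt_mul_exp hc0, ENNReal.ofReal_mul (by unfold potentialDensity; positivity),
    ENNReal.ofReal_mul (by positivity), mul_assoc, mul_left_comm (ENNReal.ofReal (Real.exp c)),
    ← ENNReal.ofReal_mul (by positivity), ← Real.exp_add, add_neg_cancel, Real.exp_zero,
    ENNReal.ofReal_one, mul_one]

theorem lintegral_potentialDensity_reindex (e : α ≃ β) (W : Matrix β β ℝ) (η : β → ℝ) :
    ∫⁻ b in {b | (schrodinger W b).PosDef}, ENNReal.ofReal (potentialDensity W η b) =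
      ∫⁻ b in {b | (schrodinger (W.submatrix e e) b).PosDef},
        ENNReal.ofReal (potentialDensity (W.submatrix e e) (η ∘ e) b) := by
  have h1 := (volume_measurePreserving_piCongrLeft (fun _ : β => ℝ) e).symm
  have hS : ∀ b : β → ℝ, schrodinger (W.submatrix e e) (b ∘ e) = (schrodinger W b).submatrix e e := by
    intro b
    ext i j
    simp [schrodinger, diagonal_apply]
  have hfun : ∀ b : β → ℝ, (MeasurableEquiv.piCongrLeft (fun _ : β => ℝ) e).symm b = b ∘ e := by
    intro b
    rfl
  have hpd : ∀ b : β → ℝ, potentialDensity (W.submatrix e e) (η ∘ e) (b ∘ e) =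
      potentialDensity W η b := by
    intro b
    unfold potentialDensity
    rw [hS, det_submatrix_equiv_self, inv_submatrix_equiv, submatrix_mulVec_equiv,
      submatrix_mulVec_equiv]
    have h2 : ∀ x y : β → ℝ, (x ∘ e) ⬝ᵥ (y ∘ e) = x ⬝ᵥ y := fun x y => by
      simp only [dotProduct, Function.comp]
      exact e.sum_comp fun i => x i * y i
    have h3 : (1 : α → ℝ) = (1 : β → ℝ) ∘ e := rfl
    have h4 : (η ∘ e) ∘ e.symm = η := by ext; simp
    have h5 : (1 : α → ℝ) ∘ e.symm = 1 := rfl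
    rw [h4, h5, h3, h2, h2, h2]
  rw [← h1.setLIntegral_comp_preimage_emb (MeasurableEquiv.measurableEmbedding _)]
  simp only [hfun, hpd, Set.preimage_ofPred_eq, hS]
  congr 2
  ext b
  simp only [Set.mem_ofPred_eq]
  refine ⟨fun h => h.submatrix e.injective, fun h => ?_⟩
  have := h.submatrix e.symm.injective
  simpa using this

theorem lintegral_potentialDensity_fin (n : ℕ) (W : Matrix (Fin n) (Fin n) ℝ) (hW : W.IsSymm)
    (hW0 : ∀ i j, 0 ≤ W i j) (η : Fin n → ℝ) (hη : ∀ i, 0 ≤ η i) :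
    ∫⁻ b in {b | (schrodinger W b).PosDef}, ENNReal.ofReal (potentialDensity W η b) =
      ENNReal.ofReal √(2 * Real.pi) ^ n := by
  induction n with
  | zero =>
    have h1 : {b : Fin 0 → ℝ | (schrodinger W b).PosDef} = Set.univ := by
      refine Set.eq_univ_of_forall fun b => ?_
      refine .of_dotProduct_mulVec_pos ?_ fun x hx => absurd (Subsingleton.elim x 0) hx
      ext i
      exact i.elim0
    rw [h1, Measure.restrict_univ, lintegral_unique]
    simp [potentialDensity, volume_pi]
  | succ n ih =>
    obtain ⟨e⟩ : Nonempty (Fin n ⊕ Unit ≃ Fin (n + 1)) :=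
      ⟨Fintype.equivOfCardEq (by simp)⟩
    rw [lintegral_potentialDensity_reindex e]
    set W' := W.submatrix e e with hW'
    have hs : W'.IsSymm := hW.submatrix e
    have hm := measurableSet_posDef_schrodinger hs
    rw [← lintegral_indicator hm,
      lintegral_sum_unit ((measurable_potentialDensity W' (η ∘ e)).ennreal_ofReal.indicator hm)]
    have hs1 : W'.toBlocks₁₁.IsSymm := hs.submatrix Sum.inl
    have key := ih W'.toBlocks₁₁ hs1 (fun i j => hW0 _ _)
      (fun i => (η ∘ e) (Sum.inl i) + W' (Sum.inl i) (Sum.inr ()))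
      (fun i => add_nonneg (hη _) (hW0 _ _))
    rw [pow_succ, ← key, ← lintegral_mul_const' _ _ ENNReal.ofReal_ne_top,
      ← lintegral_indicator (measurableSet_posDef_schrodinger hs1)]
    refine lintegral_congr fun b => ?_
    by_cases hb : (schrodinger W'.toBlocks₁₁ b).PosDef
    · rw [lintegral_potentialDensity_border hs (fun _ _ => hW0 _ _) (η := η ∘ e) (fun _ => hη _) b hb,
        Set.indicator_of_mem (s := {b | (schrodinger W'.toBlocks₁₁ b).PosDef}) (by simpa using hb)]
    · rw [Set.indicator_of_notMem (s := {b | (schrodinger W'.toBlocks₁₁ b).PosDef})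
        (by simpa using hb)]
      -- A principal block of a positive definite matrix is positive definite, so no value of the
      -- last coordinate contributes here.
      refine (lintegral_congr fun t => ?_).trans lintegral_zero
      refine Set.indicator_of_notMem (fun h => hb ?_) _
      rw [Set.mem_ofPred_eq, schrodinger_sum W' hs] at h
      exact h.submatrix (e := Sum.inl) Sum.inl_injective

/-- The normalisation of the law of the random Schrödinger potential. -/
theorem lintegral_potentialDensity {W : Matrix α α ℝ} (hW : W.IsSymm) (hW0 : ∀ i j, 0 ≤ W i j)
    {η : α → ℝ} (hη : ∀ i, 0 ≤ η i) :
    ∫⁻ b in {b | (schrodinger W b).PosDef}, ENNReal.ofReal (potentialDensity W η b) =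
      ENNReal.ofReal √(2 * Real.pi) ^ Fintype.card α := by
  rw [lintegral_potentialDensity_reindex (Fintype.equivFin α).symm]
  exact lintegral_potentialDensity_fin _ _ (hW.submatrix _) (fun _ _ => hW0 _ _) _ fun _ => hη _

end Beta

/-! ### Gaussian integrals in several variables -/

section Gaussian

variable {α : Type*} [Fintype α] [DecidableEq α]

open scoped MatrixOrder in
-- Factor M = AᵀA and substitute As; the Jacobian is |det A| = √(det M).
theorem lintegral_exp_neg_dotProduct_mulVec {M : Matrix α α ℝ} (hM : M.PosDef) :
    ∫⁻ s : α → ℝ, ENNReal.ofReal (Real.exp (-(s ⬝ᵥ M *ᵥ s) / 2)) =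
      ENNReal.ofReal (√(2 * Real.pi) ^ Fintype.card α / √M.det) := by
  have hdet := hM.det_pos
  obtain ⟨A, hA⟩ := CStarAlgebra.nonneg_iff_eq_star_mul_self.mp hM.posSemidef.nonneg
  rw [star_eq_conjTranspose, conjTranspose_eq_transpose_of_trivial] at hA
  have hdA : M.det = A.det ^ 2 := by rw [hA, det_mul, det_transpose, sq]
  have hA0 : A.det ≠ 0 := fun h => by rw [hdA, h] at hdet; simp at hdet
  have hstd : ∫⁻ s : α → ℝ, ENNReal.ofReal (Real.exp (-(s ⬝ᵥ s) / 2)) =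
      ENNReal.ofReal (√(2 * Real.pi) ^ Fintype.card α) := by
    have hi := integrable_exp_neg_mul_sq (b := 1 / 2) (by norm_num)
    have h1 : ∀ s : α → ℝ, Real.exp (-(s ⬝ᵥ s) / 2) = ∏ i, Real.exp (-(1 / 2) * s i ^ 2) := by
      intro s
      rw [← Real.exp_sum, dotProduct, ← Finset.mul_sum]
      congr 1
      simp only [sq]
      ring
    simp_rw [h1]
    rw [volume_pi, ← ofReal_integral_eq_lintegral_ofReal (Integrable.fintype_prod fun _ => hi)
      (ae_of_all _ fun _ => Finset.prod_nonneg fun _ _ => (Real.exp_pos _).le),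
      integral_fintype_prod_eq_pow (fun t : ℝ => Real.exp (-(1 / 2) * t ^ 2)),
      integral_gaussian]
    congr 4
    field_simp
  have hmap := Real.map_matrix_volume_pi_eq_smul_volume_pi hA0
  have hcont : Measurable (toLin' A) := (LinearMap.continuous_of_finiteDimensional _).measurable
  have hmeas : Measurable fun s : α → ℝ => ENNReal.ofReal (Real.exp (-(s ⬝ᵥ s) / 2)) := by
    refine Measurable.ennreal_ofReal (Continuous.measurable ?_)
    have := Continuous.dotProduct (continuous_id (X := α → ℝ)) continuous_id
    simp only [id] at this
    fun_prop
  have h2 := lintegral_map (μ := volume) hmeas hcont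
  rw [hmap, lintegral_smul_measure, hstd, smul_eq_mul, ← ENNReal.ofReal_mul (abs_nonneg _)] at h2
  have h3 : ∀ s : α → ℝ, s ⬝ᵥ M *ᵥ s = toLin' A s ⬝ᵥ toLin' A s := by
    intro s
    rw [hA, ← mulVec_mulVec, dotProduct_mulVec, vecMul_transpose, toLin'_apply]
  simp_rw [h3]
  rw [← h2, hdA, Real.sqrt_sq_eq_abs, abs_inv, inv_mul_eq_div]

end Gaussian

/-! ### From the potential to the field u -/

section ChangeOfVariables

variable {α : Type*} [Fintype α] [DecidableEq α]

/-- The potential of which `exp u` is the harmonic extension of the boundary weights `η`. -/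
def potentialOf (W : Matrix α α ℝ) (η u : α → ℝ) (i : α) : ℝ :=
  ∑ j, W i j * Real.exp (u j - u i) + η i * Real.exp (-u i)

/-- The Laplacian for the conductances `W i j * exp (u i + u j)` with killing `η i * exp (u i)`. -/
def killedLaplacian (W : Matrix α α ℝ) (η u : α → ℝ) : Matrix α α ℝ :=
  diagonal (fun i => ∑ j, W i j * Real.exp (u i + u j) + η i * Real.exp (u i)) -
    of fun i j => W i j * Real.exp (u i + u j)

theorem killedLaplacian_eq (W : Matrix α α ℝ) (η u : α → ℝ) :
    killedLaplacian W η u = diagonal (fun i => Real.exp (u i)) *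
      schrodinger W (potentialOf W η u) * diagonal fun i => Real.exp (u i) := by
  ext i j
  rw [mul_diagonal, diagonal_mul, killedLaplacian, schrodinger, Matrix.sub_apply, Matrix.sub_apply,
    of_apply]
  by_cases hij : i = j
  · subst hij
    rw [diagonal_apply_eq, diagonal_apply_eq, potentialOf, mul_sub, sub_mul, mul_add, add_mul,
      Finset.mul_sum, Finset.sum_mul, Real.exp_neg, ← mul_assoc]
    congr 1
    · congr 1
      · refine Finset.sum_congr rfl fun j _ => ?_
        rw [Real.exp_sub, Real.exp_add]
        field_simp
      · field_simp
    · rw [Real.exp_add]; ring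
  · rw [diagonal_apply_ne _ hij, diagonal_apply_ne _ hij, Real.exp_add]
    ring

theorem det_killedLaplacian (W : Matrix α α ℝ) (η u : α → ℝ) :
    (killedLaplacian W η u).det =
      Real.exp (∑ i, u i) ^ 2 * (schrodinger W (potentialOf W η u)).det := by
  rw [killedLaplacian_eq, det_mul, det_mul, det_diagonal, Real.exp_sum]
  ring

theorem dotProduct_killedLaplacian {W : Matrix α α ℝ} (hW : W.IsSymm) (η u y : α → ℝ) :
    y ⬝ᵥ killedLaplacian W η u *ᵥ y =
      (∑ i, ∑ j, W i j * Real.exp (u i + u j) * (y i - y j) ^ 2) / 2 +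
        ∑ i, η i * Real.exp (u i) * y i ^ 2 := by
  have h1 : y ⬝ᵥ killedLaplacian W η u *ᵥ y =
      ∑ i, ∑ j, W i j * Real.exp (u i + u j) * (y i ^ 2 - y i * y j) +
        ∑ i, η i * Real.exp (u i) * y i ^ 2 := by
    rw [killedLaplacian, sub_mulVec, dotProduct_sub]
    simp only [dotProduct, mulVec_diagonal]
    rw [← Finset.sum_sub_distrib, ← Finset.sum_add_distrib]
    refine Finset.sum_congr rfl fun i _ => ?_
    simp only [mulVec, dotProduct, of_apply, mul_sub, Finset.sum_sub_distrib]
    rw [add_mul, mul_add, Finset.sum_mul, Finset.mul_sum, Finset.mul_sum, add_sub_right_comm]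
    congr 1
    · congr 1 <;> refine Finset.sum_congr rfl fun j _ => by ring
    · ring
  have h2 : ∑ i, ∑ j, W i j * Real.exp (u i + u j) * (y i ^ 2 - y i * y j) =
      ∑ i, ∑ j, W i j * Real.exp (u i + u j) * (y j ^ 2 - y i * y j) := by
    rw [Finset.sum_comm]
    refine Finset.sum_congr rfl fun i _ => Finset.sum_congr rfl fun j _ => ?_
    rw [hW.apply, add_comm (u j)]
    ring
  have h3 : ∑ i, ∑ j, W i j * Real.exp (u i + u j) * (y i - y j) ^ 2 =
      ∑ i, ∑ j, W i j * Real.exp (u i + u j) * (y i ^ 2 - y i * y j) +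
      ∑ i, ∑ j, W i j * Real.exp (u i + u j) * (y j ^ 2 - y i * y j) := by
    simp_rw [← Finset.sum_add_distrib]
    refine Finset.sum_congr rfl fun i _ => Finset.sum_congr rfl fun j _ => ?_
    ring
  rw [h1, h3, ← h2]
  ring

/-- Every nonempty set of vertices is joined to its complement or to the boundary. -/
def IsGrounded (W : Matrix α α ℝ) (η : α → ℝ) : Prop :=
  ∀ Z : Set α, Z.Nonempty → ∃ i ∈ Z, 0 < η i ∨ ∃ j ∉ Z, 0 < W i j

theorem posDef_killedLaplacian {W : Matrix α α ℝ} (hW : W.IsSymm) (hW0 : ∀ i j, 0 ≤ W i j)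
    {η : α → ℝ} (hη : ∀ i, 0 ≤ η i) (hg : IsGrounded W η) (u : α → ℝ) :
    (killedLaplacian W η u).PosDef := by
  refine .of_dotProduct_mulVec_pos ?_ fun y hy => ?_
  · rw [IsHermitian, conjTranspose_eq_transpose_of_trivial]
    refine (isSymm_diagonal _).sub (IsSymm.ext fun i j => ?_)
    rw [of_apply, of_apply, hW.apply, add_comm]
  · rw [star_trivial, dotProduct_killedLaplacian hW]
    have h1 : ∀ i j, 0 ≤ W i j * Real.exp (u i + u j) * (y i - y j) ^ 2 := fun i j =>
      mul_nonneg (mul_nonneg (hW0 i j) (Real.exp_pos _).le) (sq_nonneg _)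
    have h2 : ∀ i, 0 ≤ η i * Real.exp (u i) * y i ^ 2 := fun i =>
      mul_nonneg (mul_nonneg (hη i) (Real.exp_pos _).le) (sq_nonneg _)
    have h3 : 0 ≤ ∑ i, ∑ j, W i j * Real.exp (u i + u j) * (y i - y j) ^ 2 :=
      Finset.sum_nonneg fun i _ => Finset.sum_nonneg fun j _ => h1 i j
    have h4 : 0 ≤ ∑ i, η i * Real.exp (u i) * y i ^ 2 := Finset.sum_nonneg fun i _ => h2 i
    obtain ⟨k, hk⟩ := Function.ne_iff.1 hy
    -- On the support of y, a killed vertex or an edge leaving it gives a strictly positive term of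
    -- the Dirichlet form.
    obtain ⟨i, hi, hpos | ⟨j, hj, hpos⟩⟩ := hg {i | y i ≠ 0} ⟨k, hk⟩
    · have : 0 < ∑ i, η i * Real.exp (u i) * y i ^ 2 :=
        Finset.sum_pos' (fun i _ => h2 i) ⟨i, Finset.mem_univ i,
          mul_pos (mul_pos hpos (Real.exp_pos _)) (sq_pos_of_ne_zero hi)⟩
      linarith
    · have hj0 : y j = 0 := by simpa using hj
      have hij : y i - y j ≠ 0 := by rw [hj0, sub_zero]; exact hi
      have : 0 < ∑ i, ∑ j, W i j * Real.exp (u i + u j) * (y i - y j) ^ 2 :=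
        Finset.sum_pos' (fun i _ => Finset.sum_nonneg fun j _ => h1 i j) ⟨i, Finset.mem_univ i,
          Finset.sum_pos' (fun j _ => h1 i j) ⟨j, Finset.mem_univ j,
            mul_pos (mul_pos hpos (Real.exp_pos _)) (sq_pos_of_ne_zero hij)⟩⟩
      linarith

theorem posDef_schrodinger_potentialOf {W : Matrix α α ℝ} (hW : W.IsSymm)
    (hW0 : ∀ i j, 0 ≤ W i j) {η : α → ℝ} (hη : ∀ i, 0 ≤ η i) (hg : IsGrounded W η) (u : α → ℝ) :
    (schrodinger W (potentialOf W η u)).PosDef := by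
  have h := posDef_killedLaplacian hW hW0 hη hg u
  rw [killedLaplacian_eq] at h
  set A : Matrix α α ℝ := diagonal fun i => Real.exp (u i) with hA
  have hu : IsUnit A := by
    rw [isUnit_iff_isUnit_det, hA, det_diagonal, isUnit_iff_ne_zero]
    exact Finset.prod_ne_zero_iff.2 fun i _ => (Real.exp_pos _).ne'
  have hs : star A = A := by
    rw [star_eq_conjTranspose, conjTranspose_eq_transpose_of_trivial, hA, diagonal_transpose]
  rw [← hu.posDef_star_left_conjugate_iff, hs]
  exact h

theorem schrodinger_mulVec (W : Matrix α α ℝ) (b x : α → ℝ) (i : α) :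
    (schrodinger W b *ᵥ x) i = b i * x i - ∑ j, W i j * x j := by
  rw [schrodinger, sub_mulVec, Pi.sub_apply, mulVec_diagonal]
  rfl

/-- This inverts the change of variables: u is the logarithm of H⁻¹η. It also evaluates the term
η·H⁻¹η of the density. -/
theorem schrodinger_potentialOf_mulVec_exp (W : Matrix α α ℝ) (η u : α → ℝ) :
    schrodinger W (potentialOf W η u) *ᵥ (fun i => Real.exp (u i)) = η := by
  funext i
  rw [schrodinger_mulVec, potentialOf, add_mul, Finset.sum_mul, Real.exp_neg, mul_assoc,
    inv_mul_cancel₀ (Real.exp_pos _).ne', mul_one, add_sub_right_comm, ← Finset.sum_sub_distrib]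
  refine (add_eq_right.2 (Finset.sum_eq_zero fun j _ => ?_))
  rw [Real.exp_sub]
  field_simp
  ring

theorem potentialOf_injective {W : Matrix α α ℝ} (hW : W.IsSymm) (hW0 : ∀ i j, 0 ≤ W i j)
    {η : α → ℝ} (hη : ∀ i, 0 ≤ η i) (hg : IsGrounded W η) :
    Function.Injective (potentialOf W η) := by
  intro u v huv
  have h1 := inv_mulVec_eq (posDef_schrodinger_potentialOf hW hW0 hη hg u).isUnit
    (schrodinger_potentialOf_mulVec_exp W η u)
  have h2 := inv_mulVec_eq (posDef_schrodinger_potentialOf hW hW0 hη hg v).isUnit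
    (schrodinger_potentialOf_mulVec_exp W η v)
  rw [← huv, h1] at h2
  funext i
  exact Real.exp_injective (congrFun h2 i)

/-- For surjectivity take u = log x with x = H⁻¹η ≥ 0. If x vanished somewhere, the equation at a
zero would force η = 0 there and x = 0 at its neighbours, so the zero set would not be grounded. -/
theorem range_potentialOf {W : Matrix α α ℝ} (hW : W.IsSymm) (hW0 : ∀ i j, 0 ≤ W i j)
    {η : α → ℝ} (hη : ∀ i, 0 ≤ η i) (hg : IsGrounded W η) :
    Set.range (potentialOf W η) = {b | (schrodinger W b).PosDef} := by
  ext b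
  rw [Set.mem_ofPred_eq]
  constructor
  · rintro ⟨u, rfl⟩
    exact posDef_schrodinger_potentialOf hW hW0 hη hg u
  · intro hb
    set x := (schrodinger W b)⁻¹ *ᵥ η with hx
    have hHx : schrodinger W b *ᵥ x = η := mulVec_inv_mulVec hb.isUnit η
    have hx0 : ∀ i, 0 ≤ x i := by
      refine nonneg_of_mulVec_nonneg hb (fun i j hij => ?_) fun i => ?_
      · simp [schrodinger, diagonal_apply_ne _ hij, hW0]
      · rw [hHx]; exact hη i
    have heq : ∀ i, b i * x i - ∑ j, W i j * x j = η i := fun i => by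
      rw [← schrodinger_mulVec, hHx]
    have hxpos : ∀ i, 0 < x i := by
      intro k
      refine (hx0 k).lt_of_ne' fun hk => ?_
      obtain ⟨i, hi, h⟩ := hg {i | x i = 0} ⟨k, hk⟩
      have hi0 : x i = 0 := hi
      have h1 := heq i
      rw [hi0, mul_zero, zero_sub] at h1
      have h2 : ∀ j, 0 ≤ W i j * x j := fun j => mul_nonneg (hW0 i j) (hx0 j)
      rcases h with h | ⟨j, hj, h⟩
      · linarith [Finset.sum_nonneg fun j (_ : j ∈ Finset.univ) => h2 j]
      · have hj' : x j ≠ 0 := hj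
        have : 0 < ∑ j, W i j * x j := Finset.sum_pos' (fun j _ => h2 j)
          ⟨j, Finset.mem_univ j, mul_pos h ((hx0 j).lt_of_ne' hj')⟩
        linarith [hη i]
    refine ⟨fun i => Real.log (x i), ?_⟩
    funext i
    have h1 := heq i
    have hne := (hxpos i).ne'
    simp only [potentialOf, Real.exp_sub, Real.exp_neg, Real.exp_log (hxpos _)]
    have h2 : ∑ j, W i j * (x j / x i) = (∑ j, W i j * x j) / x i := by
      rw [Finset.sum_div]
      exact Finset.sum_congr rfl fun j _ => by ring
    rw [h2, ← h1]
    field_simp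
    ring

/-- The Jacobian matrix of `potentialOf`. -/
def potentialJacobian (W : Matrix α α ℝ) (η u : α → ℝ) : Matrix α α ℝ :=
  -(diagonal (fun i => Real.exp (-u i)) * schrodinger W (potentialOf W η u) *
    diagonal fun i => Real.exp (u i))

theorem abs_det_potentialJacobian (W : Matrix α α ℝ) (η u : α → ℝ) :
    |(potentialJacobian W η u).det| = |(schrodinger W (potentialOf W η u)).det| := by
  have h : (∏ i, Real.exp (-u i)) * ∏ i, Real.exp (u i) = 1 := by
    rw [← Finset.prod_mul_distrib]
    exact Finset.prod_eq_one fun i _ => by rw [← Real.exp_add, neg_add_cancel, Real.exp_zero]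
  rw [potentialJacobian, det_neg, det_mul, det_mul, det_diagonal, det_diagonal, mul_right_comm, h,
    one_mul, abs_mul, abs_pow, abs_neg, abs_one, one_pow, one_mul]

theorem hasFDerivAt_potentialOf (W : Matrix α α ℝ) (η u : α → ℝ) :
    HasFDerivAt (potentialOf W η) (toLin' (potentialJacobian W η u)).toContinuousLinearMap u := by
  rw [hasFDerivAt_pi']
  intro i
  have hp : ∀ j, HasFDerivAt (fun u : α → ℝ => u j) (ContinuousLinearMap.proj (R := ℝ) j) u :=
    fun j => hasFDerivAt_apply j u
  have h := (HasFDerivAt.fun_sum (u := Finset.univ) fun j _ =>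
    (((hp j).sub (hp i)).exp.const_mul (W i j))).add (((hp i).neg.exp).const_mul (η i))
  refine h.congr_fderiv ?_
  ext v
  simp only [_root_.add_apply, _root_.sum_apply,
    _root_.smul_apply, _root_.sub_apply, _root_.neg_apply,
    ContinuousLinearMap.proj_apply, ContinuousLinearMap.comp_apply, smul_eq_mul,
    LinearMap.coe_toContinuousLinearMap', toLin'_apply, Pi.sub_apply, Pi.neg_apply]
  rw [potentialJacobian, neg_mulVec, ← mulVec_mulVec, ← mulVec_mulVec, Pi.neg_apply, mulVec_diagonal,
    schrodinger_mulVec]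
  simp only [mulVec_diagonal]
  rw [potentialOf, mul_sub, neg_sub, Finset.mul_sum]
  have h1 : Real.exp (-u i) * ((∑ j, W i j * Real.exp (u j - u i) + η i * Real.exp (-u i)) *
      (Real.exp (u i) * v i)) =
      ∑ j, W i j * Real.exp (u j - u i) * v i + η i * Real.exp (-u i) * v i := by
    have : Real.exp (-u i) * Real.exp (u i) = 1 := by
      rw [← Real.exp_add, neg_add_cancel, Real.exp_zero]
    rw [← Finset.sum_mul, ← add_mul]
    linear_combination (∑ j, W i j * Real.exp (u j - u i) + η i * Real.exp (-u i)) * v i * this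
  rw [h1, ← sub_sub, ← Finset.sum_sub_distrib, sub_eq_add_neg]
  congr 1
  · refine Finset.sum_congr rfl fun j _ => ?_
    rw [Real.exp_sub, Real.exp_neg]
    field_simp
  · ring

theorem potentialDensity_potentialOf {W : Matrix α α ℝ} (hW : W.IsSymm) (hW0 : ∀ i j, 0 ≤ W i j)
    {η : α → ℝ} (hη : ∀ i, 0 ≤ η i) (hg : IsGrounded W η) (u : α → ℝ) :
    potentialDensity W η (potentialOf W η u) =
      Real.exp (-(∑ i, ∑ j, W i j * (Real.cosh (u i - u j) - 1)) / 2 -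
        ∑ i, η i * (Real.cosh (u i) - 1)) / √(schrodinger W (potentialOf W η u)).det := by
  rw [potentialDensity, inv_mulVec_eq (posDef_schrodinger_potentialOf hW hW0 hη hg u).isUnit
    (schrodinger_potentialOf_mulVec_exp W η u)]
  congr 2
  have h1 : (1 : α → ℝ) ⬝ᵥ schrodinger W (potentialOf W η u) *ᵥ 1 =
      ∑ i, ∑ j, W i j * (Real.exp (u j - u i) - 1) + ∑ i, η i * Real.exp (-u i) := by
    rw [one_dotProduct, ← Finset.sum_add_distrib]
    refine Finset.sum_congr rfl fun i _ => ?_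
    rw [schrodinger_mulVec, potentialOf]
    simp only [Pi.one_apply, mul_one, mul_sub, Finset.sum_sub_distrib]
    ring
  have h2 : ∑ i, ∑ j, W i j * (Real.exp (u j - u i) - 1) =
      ∑ i, ∑ j, W i j * (Real.cosh (u i - u j) - 1) := by
    have h3 : ∑ i, ∑ j, W i j * (Real.exp (u j - u i) - 1) =
        ∑ i, ∑ j, W i j * (Real.exp (u i - u j) - 1) := by
      rw [Finset.sum_comm]
      refine Finset.sum_congr rfl fun i _ => Finset.sum_congr rfl fun j _ => ?_
      rw [hW.apply]
    have h4 : ∑ i, ∑ j, W i j * (Real.cosh (u i - u j) - 1) =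
        (∑ i, ∑ j, W i j * (Real.exp (u j - u i) - 1) +
          ∑ i, ∑ j, W i j * (Real.exp (u i - u j) - 1)) / 2 := by
      rw [← Finset.sum_add_distrib, Finset.sum_div]
      refine Finset.sum_congr rfl fun i _ => ?_
      rw [← Finset.sum_add_distrib, Finset.sum_div]
      refine Finset.sum_congr rfl fun j _ => ?_
      rw [Real.cosh_eq, neg_sub]
      ring
    rw [h4, ← h3]
    ring
  have h5 : ∑ i, η i * (Real.cosh (u i) - 1) =
      (∑ i, η i * Real.exp (-u i)) / 2 + (η ⬝ᵥ fun i => Real.exp (u i)) / 2 - η ⬝ᵥ 1 := by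
    simp only [dotProduct, Finset.sum_div, ← Finset.sum_add_distrib, ← Finset.sum_sub_distrib]
    refine Finset.sum_congr rfl fun i _ => ?_
    rw [Real.cosh_eq, Pi.one_apply]
    ring
  rw [h1, h2, h5]
  ring

/-- The Jacobian contributes det H and the density 1/√(det H), leaving √(det H). This is e^{-Σu}
times the square root of the determinant of the killed Laplacian. -/
theorem lintegral_sqrt_det_killedLaplacian {W : Matrix α α ℝ} (hW : W.IsSymm)
    (hW0 : ∀ i j, 0 ≤ W i j) {η : α → ℝ} (hη : ∀ i, 0 ≤ η i) (hg : IsGrounded W η) :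
    ∫⁻ u : α → ℝ, ENNReal.ofReal (Real.exp (-∑ i, u i) *
        Real.exp (-(∑ i, ∑ j, W i j * (Real.cosh (u i - u j) - 1)) / 2 -
          ∑ i, η i * (Real.cosh (u i) - 1)) * √(killedLaplacian W η u).det) =
      ENNReal.ofReal √(2 * Real.pi) ^ Fintype.card α := by
  have key := lintegral_image_eq_lintegral_abs_det_fderiv_mul volume MeasurableSet.univ
    (fun u _ => (hasFDerivAt_potentialOf W η u).hasFDerivWithinAt)
    (potentialOf_injective hW hW0 hη hg).injOn
    (fun b => ENNReal.ofReal (potentialDensity W η b))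
  rw [Set.image_univ, range_potentialOf hW hW0 hη hg, lintegral_potentialDensity hW hW0 hη,
    Measure.restrict_univ] at key
  rw [key]
  refine lintegral_congr fun u => ?_
  have hdet := (posDef_schrodinger_potentialOf hW hW0 hη hg u).det_pos
  rw [← ENNReal.ofReal_mul (abs_nonneg _), potentialDensity_potentialOf hW hW0 hη hg]
  congr 1
  have h1 : (toLin' (potentialJacobian W η u)).toContinuousLinearMap.det =
      (potentialJacobian W η u).det := by
    rw [ContinuousLinearMap.det, LinearMap.coe_toContinuousLinearMap, LinearMap.det_toLin']
  rw [h1, abs_det_potentialJacobian, abs_of_pos hdet, det_killedLaplacian,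
    Real.sqrt_mul (sq_nonneg _), Real.sqrt_sq (Real.exp_pos _).le]
  have h2 : Real.exp (-∑ i, u i) * Real.exp (∑ i, u i) = 1 := by
    rw [← Real.exp_add, neg_add_cancel, Real.exp_zero]
  set T := Real.exp (-(∑ i, ∑ j, W i j * (Real.cosh (u i - u j) - 1)) / 2 -
          ∑ i, η i * (Real.cosh (u i) - 1))
  set δ := (schrodinger W (potentialOf W η u)).det
  rw [mul_div_left_comm, Real.div_sqrt]
  linear_combination T * √δ * h2

end ChangeOfVariables

/-! ### Multigraphs with a root: total mass at fixed weights -/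

section Multigraph

variable {V E : Type*} [Fintype V] [DecidableEq V] [Fintype E]

/-- `δ_x - δ_y`, as a functional on `H0 o`. -/
def dipole (o x y : V) (k : {k : V // k ≠ o}) : ℝ :=
  (if k.1 = x then 1 else 0) - (if k.1 = y then 1 else 0)

/-- The Laplacian of the multigraph with ends `p`, `q` and conductances `c`, with the row and the
column of `o` deleted. -/
def reducedLaplacian (o : V) (p q : E → V) (c : E → ℝ) : Matrix {k : V // k ≠ o} {k : V // k ≠ o} ℝ :=
  ∑ e, c e • vecMulVec (dipole o (p e) (q e)) (dipole o (p e) (q e))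

/-- A multigraph is connected if a nonempty set of vertices that no edge leaves is everything. -/
def IsConnectedMultigraph (p q : E → V) : Prop :=
  ∀ S : Set V, S.Nonempty → (∀ e, p e ∈ S ↔ q e ∈ S) → S = Set.univ

/-- The total weight of the edges between `i` and `j` (twice that if `i = j`). -/
def totalWeight (p q : E → V) (w : E → ℝ) (i j : V) : ℝ :=
  ∑ e, w e * ((if i = p e then 1 else 0) * (if j = q e then 1 else 0) +
    (if i = q e then 1 else 0) * (if j = p e then 1 else 0))

@[simp]
theorem H0.toFun_self {o : V} (v : H0 o) : v.toFun o = 0 := by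
  simp [H0.toFun]

@[simp]
theorem H0.toFun_coe {o : V} (v : H0 o) (k : {k : V // k ≠ o}) : v.toFun k.1 = v k := by
  simp [H0.toFun, k.2]

theorem sum_eq_root_add (o : V) (f : V → ℝ) : ∑ i, f i = f o + ∑ i : {k : V // k ≠ o}, f i := by
  rw [← Fintype.sum_eq_add_sum_subtype_ne]

theorem sum_toFun {o : V} (v : H0 o) : ∑ i, v.toFun i = ∑ i, v i := by
  rw [sum_eq_root_add o]
  simp

theorem dipole_dotProduct {o : V} (x y : V) (v : H0 o) :
    dipole o x y ⬝ᵥ v = v.toFun x - v.toFun y := by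
  have h : ∀ z : V, ∑ k : {k : V // k ≠ o}, (if k.1 = z then (1 : ℝ) else 0) * v k = v.toFun z := by
    intro z
    have h1 := sum_eq_root_add o fun k => (if k = z then (1 : ℝ) else 0) * v.toFun k
    simp only [H0.toFun_self, mul_zero, zero_add, H0.toFun_coe] at h1
    rw [← h1]
    simp
  simp only [dotProduct, dipole, sub_mul, Finset.sum_sub_distrib, h]

theorem reducedLaplacian_mulVec {o : V} (p q : E → V) (c : E → ℝ) (v : H0 o) :
    reducedLaplacian o p q c *ᵥ v =
      ∑ e, (c e * (v.toFun (p e) - v.toFun (q e))) • dipole o (p e) (q e) := by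
  rw [reducedLaplacian, sum_mulVec]
  refine Finset.sum_congr rfl fun e _ => ?_
  rw [smul_mulVec, vecMulVec_mulVec, dipole_dotProduct, mul_smul]
  ext k
  simp [mul_comm]

theorem dotProduct_reducedLaplacian {o : V} (p q : E → V) (c : E → ℝ) (v : H0 o) :
    v ⬝ᵥ reducedLaplacian o p q c *ᵥ v = ∑ e, c e * (v.toFun (p e) - v.toFun (q e)) ^ 2 := by
  rw [reducedLaplacian_mulVec, dotProduct_sum]
  refine Finset.sum_congr rfl fun e _ => ?_
  rw [dotProduct_smul, dotProduct_comm, dipole_dotProduct, smul_eq_mul]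
  ring

theorem totalWeight_comm (p q : E → V) (w : E → ℝ) (i j : V) :
    totalWeight p q w i j = totalWeight p q w j i := by
  unfold totalWeight
  refine Finset.sum_congr rfl fun e _ => ?_
  ring

theorem sum_totalWeight_mul (p q : E → V) (w : E → ℝ) (i : V) (g : V → ℝ) :
    ∑ j, totalWeight p q w i j * g j =
      ∑ e, w e * ((if i = p e then 1 else 0) * g (q e) + (if i = q e then 1 else 0) * g (p e)) := by
  simp only [totalWeight, Finset.sum_mul]
  rw [Finset.sum_comm]
  refine Finset.sum_congr rfl fun e _ => ?_
  simp only [mul_assoc, ← Finset.mul_sum, add_mul, Finset.sum_add_distrib]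
  simp

theorem sum_sum_totalWeight_mul (p q : E → V) (w : E → ℝ) (g : V → V → ℝ)
    (hg : ∀ i j, g i j = g j i) :
    ∑ i, ∑ j, totalWeight p q w i j * g i j = 2 * ∑ e, w e * g (p e) (q e) := by
  simp only [sum_totalWeight_mul]
  rw [Finset.sum_comm, Finset.mul_sum]
  refine Finset.sum_congr rfl fun e _ => ?_
  rw [← Finset.mul_sum, Finset.sum_add_distrib]
  simp only [ite_mul, one_mul, zero_mul, Finset.sum_ite_eq', Finset.mem_univ, if_true]
  rw [hg (q e)]
  ring

theorem sum_edges_eq (o : V) (p q : E → V) (w : E → ℝ) (g : V → V → ℝ)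
    (hg : ∀ i j, g i j = g j i) (h0 : g o o = 0) :
    ∑ e, w e * g (p e) (q e) =
      (∑ i : {k : V // k ≠ o}, ∑ j : {k : V // k ≠ o}, totalWeight p q w i j * g i j) / 2 +
        ∑ i : {k : V // k ≠ o}, totalWeight p q w i o * g i o := by
  have h1 := sum_sum_totalWeight_mul p q w g hg
  rw [sum_eq_root_add o] at h1
  simp only [sum_eq_root_add o (fun j => totalWeight p q w _ j * g _ j), h0, mul_zero, zero_add,
    Finset.sum_add_distrib] at h1
  have h2 : ∀ i, totalWeight p q w o i * g o i = totalWeight p q w i o * g i o := fun i => by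
    rw [totalWeight_comm, hg]
  simp only [h2] at h1
  linarith

/-- Since u vanishes at o, the edges to o act as killing. A loop has zero dipole, and its
contribution to `totalWeight` cancels between the row sum and the diagonal entry. -/
theorem reducedLaplacian_eq_killedLaplacian {o : V} (p q : E → V) (w : E → ℝ) (u : H0 o) :
    reducedLaplacian o p q (fun e => w e * Real.exp (u.toFun (p e) + u.toFun (q e))) =
      killedLaplacian (of fun i j : {k : V // k ≠ o} => totalWeight p q w i j)
        (fun i => totalWeight p q w i o) u := by
  have hdiag : ∀ i : {k : V // k ≠ o},
      ∑ j : {k : V // k ≠ o}, totalWeight p q w i j * Real.exp (u i + u j) +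
        totalWeight p q w i o * Real.exp (u i) =
      ∑ e, w e * Real.exp (u.toFun (p e) + u.toFun (q e)) *
        ((if i.1 = p e then 1 else 0) + (if i.1 = q e then 1 else 0)) := by
    intro i
    have h1 := sum_eq_root_add o fun j => totalWeight p q w i j * Real.exp (u i + u.toFun j)
    simp only [H0.toFun_self, add_zero, H0.toFun_coe] at h1
    rw [add_comm, ← h1, sum_totalWeight_mul]
    refine Finset.sum_congr rfl fun e _ => ?_
    have hp : (if i.1 = p e then (1 : ℝ) else 0) * Real.exp (u i + u.toFun (q e)) =
        (if i.1 = p e then (1 : ℝ) else 0) * Real.exp (u.toFun (p e) + u.toFun (q e)) := by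
      split_ifs with h
      · rw [← h, H0.toFun_coe]
      · simp
    have hq : (if i.1 = q e then (1 : ℝ) else 0) * Real.exp (u i + u.toFun (p e)) =
        (if i.1 = q e then (1 : ℝ) else 0) * Real.exp (u.toFun (p e) + u.toFun (q e)) := by
      split_ifs with h
      · rw [← h, H0.toFun_coe, add_comm]
      · simp
    rw [hp, hq]
    ring
  have hoff : ∀ i j : {k : V // k ≠ o}, totalWeight p q w i j * Real.exp (u i + u j) =
      ∑ e, w e * Real.exp (u.toFun (p e) + u.toFun (q e)) *
        ((if i.1 = p e then 1 else 0) * (if j.1 = q e then 1 else 0) +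
          (if i.1 = q e then 1 else 0) * (if j.1 = p e then 1 else 0)) := by
    intro i j
    rw [totalWeight, Finset.sum_mul]
    refine Finset.sum_congr rfl fun e _ => ?_
    have hp : (if i.1 = p e then (1 : ℝ) else 0) * (if j.1 = q e then 1 else 0) *
        Real.exp (u i + u j) = (if i.1 = p e then (1 : ℝ) else 0) * (if j.1 = q e then 1 else 0) *
        Real.exp (u.toFun (p e) + u.toFun (q e)) := by
      split_ifs with h h'
      · rw [← h, ← h', H0.toFun_coe, H0.toFun_coe]
      all_goals simp
    have hq : (if i.1 = q e then (1 : ℝ) else 0) * (if j.1 = p e then 1 else 0) *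
        Real.exp (u i + u j) = (if i.1 = q e then (1 : ℝ) else 0) * (if j.1 = p e then 1 else 0) *
        Real.exp (u.toFun (p e) + u.toFun (q e)) := by
      split_ifs with h h'
      · rw [← h, ← h', H0.toFun_coe, H0.toFun_coe, add_comm]
      all_goals simp
    linear_combination w e * (hp + hq)
  ext i j
  rw [killedLaplacian, Matrix.sub_apply, of_apply, reducedLaplacian, Matrix.sum_apply]
  simp only [of_apply]
  rw [hoff, diagonal_apply, hdiag]
  split_ifs with hij
  · subst hij
    rw [← Finset.sum_sub_distrib]
    refine Finset.sum_congr rfl fun e _ => ?_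
    simp only [Matrix.smul_apply, vecMulVec_apply, dipole, smul_eq_mul]
    split_ifs <;> ring
  · rw [zero_sub, ← Finset.sum_neg_distrib]
    refine Finset.sum_congr rfl fun e _ => ?_
    have hij' : i.1 ≠ j.1 := fun h => hij (Subtype.ext h)
    have h1 : ∀ z, (if i.1 = z then (1 : ℝ) else 0) * (if j.1 = z then 1 else 0) = 0 := by
      intro z
      split_ifs with h h' <;> simp
      exact hij' (h.trans h'.symm)
    simp only [Matrix.smul_apply, vecMulVec_apply, dipole, smul_eq_mul]
    linear_combination w e * Real.exp (u.toFun (p e) + u.toFun (q e)) * (h1 (p e) + h1 (q e))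

theorem totalWeight_nonneg (p q : E → V) {w : E → ℝ} (hw : ∀ e, 0 ≤ w e) (i j : V) :
    0 ≤ totalWeight p q w i j := by
  refine Finset.sum_nonneg fun e _ => mul_nonneg (hw e) ?_
  positivity

theorem totalWeight_ends_pos (p q : E → V) {w : E → ℝ} (hw : ∀ e, 0 < w e) (e : E) :
    0 < totalWeight p q w (p e) (q e) := by
  refine Finset.sum_pos' (fun e _ => mul_nonneg (hw e).le (by positivity)) ⟨e, Finset.mem_univ e, ?_⟩
  refine mul_pos (hw e) ?_
  simp only [if_true, mul_one]
  positivity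

/-- An ungrounded set would be closed under the edges of the multigraph while missing o. -/
theorem isGrounded_totalWeight {p q : E → V} (hconn : IsConnectedMultigraph p q) {w : E → ℝ}
    (hw : ∀ e, 0 < w e) (o : V) :
    IsGrounded (of fun i j : {k : V // k ≠ o} => totalWeight p q w i j)
      (fun i => totalWeight p q w i o) := by
  intro Z hZ
  by_contra! hcon
  have hS : ∀ e, p e ∈ Subtype.val '' Z ↔ q e ∈ Subtype.val '' Z := by
    have hstep : ∀ i ∈ Z, ∀ j : V, 0 < totalWeight p q w i j → j ∈ Subtype.val '' Z := by
      intro i hi j hij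
      by_cases hj : j = o
      · subst hj
        exact absurd hij (not_lt.2 (hcon i hi).1)
      · by_contra hjZ
        exact absurd hij (not_lt.2 ((hcon i hi).2 ⟨j, hj⟩ fun h => hjZ ⟨_, h, rfl⟩))
    intro e
    constructor
    · rintro ⟨i, hi, hie⟩
      exact hstep i hi _ (by rw [hie]; exact totalWeight_ends_pos p q hw e)
    · rintro ⟨i, hi, hie⟩
      exact hstep i hi _ (by rw [hie, totalWeight_comm]; exact totalWeight_ends_pos p q hw e)
  have huniv := hconn _ (hZ.image _) hS
  have ho : o ∈ Subtype.val '' Z := by rw [huniv]; trivial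
  obtain ⟨i, -, hi⟩ := ho
  exact i.2 hi

theorem posDef_reducedLaplacian {p q : E → V} (hconn : IsConnectedMultigraph p q) {c : E → ℝ}
    (hc : ∀ e, 0 < c e) (o : V) : (reducedLaplacian o p q c).PosDef := by
  have h := reducedLaplacian_eq_killedLaplacian (o := o) p q c 0
  have h0 : ∀ k, H0.toFun (0 : H0 o) k = 0 := fun k => by simp [H0.toFun]
  simp only [h0, add_zero, Real.exp_zero, mul_one] at h
  rw [h]
  exact posDef_killedLaplacian (IsSymm.ext fun i j => totalWeight_comm p q c _ _)
    (fun i j => totalWeight_nonneg p q (fun e => (hc e).le) _ _)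
    (fun i => totalWeight_nonneg p q (fun e => (hc e).le) _ _) (isGrounded_totalWeight hconn hc o) 0

theorem continuous_toFun {o : V} (k : V) : Continuous fun u : H0 o => u.toFun k := by
  unfold H0.toFun
  split_ifs with h
  · exact continuous_const
  · exact continuous_apply _

theorem continuous_det_reducedLaplacian (o : V) (p q : E → V) :
    Continuous fun c => (reducedLaplacian o p q c).det := by
  refine Continuous.matrix_det ?_
  unfold reducedLaplacian
  fun_prop

theorem continuous_B {o : V} (x y : V) :
    Continuous fun us : H0 o × H0 o => B us.1.toFun us.2.toFun x y := by
  have h := fun k => continuous_toFun (o := o) k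
  unfold B
  have h1 := fun k => (h k).comp (continuous_fst (X := H0 o) (Y := H0 o))
  have h2 := fun k => (h k).comp (continuous_snd (X := H0 o) (Y := H0 o))
  simp only [Function.comp_def] at h1 h2
  fun_prop

/-- For fixed u the variable s is Gaussian with precision matrix the reduced Laplacian L, so
integrating it turns det L into √(det L). The u-integral is then
`lintegral_sqrt_det_killedLaplacian`. Each integration yields (2π)^{(N-1)/2}. -/
theorem lintegral_fixed_weights {p q : E → V} (hconn : IsConnectedMultigraph p q) {w : E → ℝ}
    (hw : ∀ e, 0 < w e) (o : V) :
    ∫⁻ us : H0 o × H0 o, ENNReal.ofReal (Real.exp (-∑ j, us.1.toFun j) *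
        Real.exp (-∑ e, w e * (B us.1.toFun us.2.toFun (p e) (q e) - 1)) *
        (reducedLaplacian o p q
          (fun e => w e * Real.exp (us.1.toFun (p e) + us.1.toFun (q e)))).det) =
      ENNReal.ofReal ((2 * Real.pi) ^ (Fintype.card V - 1)) := by
  set n := Fintype.card {k : V // k ≠ o} with hn
  have hcard : Fintype.card V - 1 = n := by
    rw [hn, Fintype.card_subtype_compl, Fintype.card_subtype_eq]
  have hmeas : Measurable fun us : H0 o × H0 o => ENNReal.ofReal (Real.exp (-∑ j, us.1.toFun j) *
        Real.exp (-∑ e, w e * (B us.1.toFun us.2.toFun (p e) (q e) - 1)) *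
        (reducedLaplacian o p q
          (fun e => w e * Real.exp (us.1.toFun (p e) + us.1.toFun (q e)))).det) := by
    refine Measurable.ennreal_ofReal (Continuous.measurable ?_)
    have h1 := fun k => (continuous_toFun (o := o) k).comp (continuous_fst (X := H0 o) (Y := H0 o))
    simp only [Function.comp_def] at h1
    have h2 := fun x y => continuous_B (o := o) x y
    have h3 : Continuous fun us : H0 o × H0 o => (reducedLaplacian o p q
          (fun e => w e * Real.exp (us.1.toFun (p e) + us.1.toFun (q e)))).det := by
      refine (continuous_det_reducedLaplacian o p q).comp (f := fun us : H0 o × H0 o => fun e =>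
        w e * Real.exp (us.1.toFun (p e) + us.1.toFun (q e))) ?_
      fun_prop
    fun_prop
  rw [Measure.volume_eq_prod, lintegral_prod _ hmeas.aemeasurable]
  set W : Matrix {k : V // k ≠ o} {k : V // k ≠ o} ℝ := of fun i j => totalWeight p q w i j with hW
  set η : {k : V // k ≠ o} → ℝ := fun i => totalWeight p q w i o with hη
  have hinner : ∀ u : H0 o, ∫⁻ s : H0 o, ENNReal.ofReal (Real.exp (-∑ j, u.toFun j) *
        Real.exp (-∑ e, w e * (B u.toFun s.toFun (p e) (q e) - 1)) *
        (reducedLaplacian o p q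
          (fun e => w e * Real.exp (u.toFun (p e) + u.toFun (q e)))).det) =
      ENNReal.ofReal (Real.exp (-∑ i, u i) *
        Real.exp (-(∑ i, ∑ j, W i j * (Real.cosh (u i - u j) - 1)) / 2 -
          ∑ i, η i * (Real.cosh (u i) - 1)) * √(killedLaplacian W η u).det) *
        ENNReal.ofReal (√(2 * Real.pi) ^ n) := by
    intro u
    rw [← reducedLaplacian_eq_killedLaplacian]
    set c : E → ℝ := fun e => w e * Real.exp (u.toFun (p e) + u.toFun (q e)) with hc
    have hpd : (reducedLaplacian o p q c).PosDef :=
      posDef_reducedLaplacian hconn (fun e => mul_pos (hw e) (Real.exp_pos _)) o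
    have hsum := sum_edges_eq o p q w (fun i j => Real.cosh (u.toFun i - u.toFun j) - 1)
      (fun i j => by rw [← Real.cosh_neg, neg_sub]) (by simp)
    simp only [H0.toFun_coe, H0.toFun_self, sub_zero] at hsum
    have hB : ∀ s : H0 o, Real.exp (-∑ e, w e * (B u.toFun s.toFun (p e) (q e) - 1)) =
        Real.exp (-(∑ i, ∑ j, W i j * (Real.cosh (u i - u j) - 1)) / 2 -
          ∑ i, η i * (Real.cosh (u i) - 1)) *
          Real.exp (-(s ⬝ᵥ reducedLaplacian o p q c *ᵥ s) / 2) := by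
      intro s
      rw [← Real.exp_add, dotProduct_reducedLaplacian]
      congr 1
      have h1 : ∑ e, w e * (B u.toFun s.toFun (p e) (q e) - 1) =
          ∑ e, w e * (Real.cosh (u.toFun (p e) - u.toFun (q e)) - 1) +
            (∑ e, c e * (s.toFun (p e) - s.toFun (q e)) ^ 2) / 2 := by
        rw [Finset.sum_div, ← Finset.sum_add_distrib]
        refine Finset.sum_congr rfl fun e _ => ?_
        rw [B, hc]
        ring
      rw [h1, hsum]
      simp only [hW, hη, of_apply]
      ring
    simp only [hB, sum_toFun]
    set T := Real.exp (-(∑ i, ∑ j, W i j * (Real.cosh (u i - u j) - 1)) / 2 -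
          ∑ i, η i * (Real.cosh (u i) - 1)) with hT
    set δ := (reducedLaplacian o p q c).det with hδ
    have hδ0 : 0 < δ := hpd.det_pos
    have h2 : ∀ s : H0 o, Real.exp (-∑ i, u i) *
        (T * Real.exp (-(s ⬝ᵥ reducedLaplacian o p q c *ᵥ s) / 2)) * δ =
        (Real.exp (-∑ i, u i) * T * δ) * Real.exp (-(s ⬝ᵥ reducedLaplacian o p q c *ᵥ s) / 2) :=
      fun s => by ring
    have hT0 : 0 ≤ Real.exp (-∑ i, u i) * T * δ := by positivity
    simp only [h2, ENNReal.ofReal_mul hT0]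
    rw [lintegral_const_mul' _ _ ENNReal.ofReal_ne_top, lintegral_exp_neg_dotProduct_mulVec hpd,
      ← ENNReal.ofReal_mul hT0, ← ENNReal.ofReal_mul (by positivity)]
    congr 1
    have h3 : √δ * √δ = δ := Real.mul_self_sqrt hδ0.le
    have h4 : √δ ≠ 0 := (Real.sqrt_pos.2 hδ0).ne'
    rw [← hδ, ← hn]
    field_simp
    rw [sq, h3]
  simp only [hinner]
  rw [lintegral_mul_const' _ _ ENNReal.ofReal_ne_top, lintegral_sqrt_det_killedLaplacian (W := W) (η := η)
    (IsSymm.ext fun i j => totalWeight_comm p q w _ _)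
    (fun i j => totalWeight_nonneg p q (fun e => (hw e).le) _ _)
    (fun i => totalWeight_nonneg p q (fun e => (hw e).le) _ _) (isGrounded_totalWeight hconn hw o),
    ← ENNReal.ofReal_pow (by positivity), ← hn, ← ENNReal.ofReal_mul (by positivity), ← mul_pow,
    Real.mul_self_sqrt (by positivity), hcard]

end Multigraph

/-! ### Functions affine in each variable -/

section Multiaffine

variable {E : Type*} [Fintype E] [DecidableEq E]

/-- `f` is an affine function of each of its variables. -/
def IsMultiaffine (f : (E → ℝ) → ℝ) : Prop :=
  ∀ c e, ∃ β γ : ℝ, ∀ t, f (Function.update c e t) = β + γ * t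

/-- Interpolation between 0 and 1 in each variable of A in turn. -/
theorem IsMultiaffine.eq_sum_powerset {f : (E → ℝ) → ℝ} (hf : IsMultiaffine f) (A : Finset E)
    (w : E → ℝ) :
    f w = ∑ S ∈ A.powerset, f (fun e => if e ∈ A then (if e ∈ S then 1 else 0) else w e) *
      ∏ e ∈ A, (if e ∈ S then w e else 1 - w e) := by
  induction A using Finset.induction_on with
  | empty => simp
  | insert e A he ih =>
    rw [ih, Finset.sum_powerset_insert he, ← Finset.sum_add_distrib]
    refine Finset.sum_congr rfl fun S hS => ?_
    have heS : e ∉ S := fun h => he (Finset.mem_powerset.1 hS h)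
    rw [Finset.prod_insert he, Finset.prod_insert he, if_neg heS, if_pos (Finset.mem_insert_self _ _)]
    have hprod : ∏ x ∈ A, (if x ∈ insert e S then w x else 1 - w x) =
        ∏ x ∈ A, (if x ∈ S then w x else 1 - w x) := by
      refine Finset.prod_congr rfl fun x hx => ?_
      have hxe : x ≠ e := fun h => he (h ▸ hx)
      simp [Finset.mem_insert, hxe]
    rw [hprod]
    set c : E → ℝ := fun x => if x ∈ A then (if x ∈ S then 1 else 0) else w x with hc
    have h0 : (fun x => if x ∈ insert e A then (if x ∈ S then (1 : ℝ) else 0) else w x) =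
        Function.update c e 0 := by
      funext x
      by_cases hx : x = e
      · subst hx; simp [heS]
      · simp [hc, hx, Finset.mem_insert]
    have h1 : (fun x => if x ∈ insert e A then (if x ∈ insert e S then (1 : ℝ) else 0) else w x) =
        Function.update c e 1 := by
      funext x
      by_cases hx : x = e
      · subst hx; simp
      · simp [hc, hx, Finset.mem_insert]
    have h2 : c = Function.update c e (w e) := by
      rw [eq_comm, Function.update_eq_self_iff, hc]
      simp [he]
    obtain ⟨β, γ, h⟩ := hf c e
    rw [h0, h1, h 0, h 1]
    conv_lhs => rw [h2, h]
    ring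

theorem IsMultiaffine.eq_sum {f : (E → ℝ) → ℝ} (hf : IsMultiaffine f) (w : E → ℝ) :
    f w = ∑ S : Finset E, f (fun e => if e ∈ S then 1 else 0) *
      ∏ e, (if e ∈ S then w e else 1 - w e) := by
  rw [hf.eq_sum_powerset Finset.univ w]
  simp

theorem IsMultiaffine.comp_mul {f : (E → ℝ) → ℝ} (hf : IsMultiaffine f) (k : E → ℝ) :
    IsMultiaffine fun w => f fun e => w e * k e := by
  intro c e
  obtain ⟨β, γ, h⟩ := hf (fun e => c e * k e) e
  refine ⟨β, γ * k e, fun t => ?_⟩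
  have : (fun x => Function.update c e t x * k x) =
      Function.update (fun e => c e * k e) e (t * k e) := by
    funext x
    by_cases hx : x = e
    · subst hx; simp
    · simp [hx]
  simp only [this, h]
  ring

/-- A multiaffine function that is nonnegative on the positive orthant is monotone there. -/
theorem IsMultiaffine.le_of_le {f : (E → ℝ) → ℝ} (hf : IsMultiaffine f)
    (h0 : ∀ c, (∀ e, 0 ≤ c e) → 0 ≤ f c) {c c' : E → ℝ} (hc : ∀ e, 0 ≤ c e)
    (hcc : ∀ e, c e ≤ c' e) : f c ≤ f c' := by
  have hstep : ∀ A : Finset E, f c ≤ f fun e => if e ∈ A then c' e else c e := by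
    intro A
    induction A using Finset.induction_on with
    | empty => simp
    | insert e A he ih =>
      refine ih.trans ?_
      set g : E → ℝ := fun e => if e ∈ A then c' e else c e with hg
      have h1 : (fun x => if x ∈ insert e A then c' x else c x) = Function.update g e (c' e) := by
        funext x
        by_cases hx : x = e
        · subst hx; simp
        · simp [hg, hx, Finset.mem_insert]
      have h2 : g = Function.update g e (c e) := by
        rw [eq_comm, Function.update_eq_self_iff, hg]
        simp [he]
      have hg0 : ∀ x, 0 ≤ g x := by
        intro x
        simp only [hg]
        split_ifs
        · exact (hc x).trans (hcc x)
        · exact hc x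
      obtain ⟨β, γ, h⟩ := hf g e
      have hγ : 0 ≤ γ := by
        by_contra! hneg
        have hβ : 0 ≤ β := by
          have := h 0
          rw [mul_zero, add_zero] at this
          rw [← this]
          refine h0 _ fun x => ?_
          by_cases hx : x = e
          · subst hx; simp
          · simpa [hx] using hg0 x
        -- At this t the affine function takes the value -1, contradicting nonnegativity.
        set t := (β + 1) / -γ with ht
        have ht0 : 0 ≤ t := by
          have : 0 < -γ := by linarith
          positivity
        have := h0 (Function.update g e t) fun x => by
          by_cases hx : x = e
          · subst hx; simpa using ht0
          · simpa [hx] using hg0 x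
        rw [h] at this
        have h3 : γ * t = -(β + 1) := by
          rw [ht, div_neg, mul_neg, mul_div_cancel₀ _ hneg.ne]
        linarith
      rw [h1, h]
      conv_lhs => rw [h2, h]
      have := mul_le_mul_of_nonneg_left (hcc e) hγ
      linarith
  simpa using hstep Finset.univ

end Multiaffine

/-! ### Averages over independent Gamma weights -/

section Gamma

theorem integrableOn_gamma {a b : ℝ} (ha : 0 < a) (hb : 0 < b) :
    IntegrableOn (fun t : ℝ => Real.exp (-(t * b)) * t ^ (a - 1) / Real.Gamma a) (Set.Ioi 0) ∧
      ∫ t in Set.Ioi (0 : ℝ), Real.exp (-(t * b)) * t ^ (a - 1) / Real.Gamma a = b ^ (-a) := by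
  have hΓ := Real.Gamma_pos_of_pos ha
  have h := Real.integral_rpow_mul_exp_neg_mul_Ioi ha hb
  have hval : ∫ t in Set.Ioi (0 : ℝ), Real.exp (-(t * b)) * t ^ (a - 1) / Real.Gamma a =
      b ^ (-a) := by
    rw [integral_div]
    have : ∀ t : ℝ, Real.exp (-(t * b)) * t ^ (a - 1) = t ^ (a - 1) * Real.exp (-(b * t)) :=
      fun t => by rw [mul_comm t b, mul_comm]
    simp only [this]
    rw [h, mul_div_assoc, div_self hΓ.ne', mul_one, one_div, Real.inv_rpow hb.le,
      Real.rpow_neg hb.le]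
  refine ⟨?_, hval⟩
  by_contra hn
  rw [integral_undef hn] at hval
  exact (Real.rpow_pos_of_pos hb _).ne hval

theorem integrableOn_mul_gamma {a b : ℝ} (ha : 0 < a) (hb : 0 < b) :
    IntegrableOn (fun t : ℝ => t * (Real.exp (-(t * b)) * t ^ (a - 1) / Real.Gamma a))
        (Set.Ioi 0) ∧
      ∫ t in Set.Ioi (0 : ℝ), t * (Real.exp (-(t * b)) * t ^ (a - 1) / Real.Gamma a) =
        b ^ (-a) * (a / b) := by
  have hΓ := Real.Gamma_pos_of_pos ha
  obtain ⟨hi, hv⟩ := integrableOn_gamma (a := a + 1) (by linarith) hb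
  have heq : Set.EqOn
      (fun t : ℝ => a * (Real.exp (-(t * b)) * t ^ (a + 1 - 1) / Real.Gamma (a + 1)))
      (fun t : ℝ => t * (Real.exp (-(t * b)) * t ^ (a - 1) / Real.Gamma a)) (Set.Ioi 0) := by
    intro t ht
    have ht : 0 < t := ht
    simp only
    rw [Real.Gamma_add_one ha.ne', add_sub_cancel_right, Real.rpow_sub_one ht.ne']
    field_simp
  refine ⟨IntegrableOn.congr_fun (hi.const_mul a) heq measurableSet_Ioi, ?_⟩
  rw [← setIntegral_congr_fun measurableSet_Ioi heq, integral_const_mul, hv, neg_add,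
    Real.rpow_add hb, Real.rpow_neg_one]
  ring

variable {E : Type*} [Fintype E] [DecidableEq E]

/-- By independence, the average of a multiaffine function is its value at the means a_e / b_e. The
interpolation terms have signs, so they are integrated as real functions; nonnegativity of f gives
the passage to `lintegral`. -/
theorem lintegral_multiaffine_gamma {f : (E → ℝ) → ℝ} (hf : IsMultiaffine f)
    (h0 : ∀ c, (∀ e, 0 ≤ c e) → 0 ≤ f c) {a b : E → ℝ} (ha : ∀ e, 0 < a e) (hb : ∀ e, 0 < b e) :
    ∫⁻ w in {w : E → ℝ | ∀ e, 0 < w e}, ENNReal.ofReal (f w *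
        ∏ e, Real.exp (-(w e * b e)) * w e ^ (a e - 1) / Real.Gamma (a e)) =
      ENNReal.ofReal (f (fun e => a e / b e) * ∏ e, b e ^ (-a e)) := by
  have hset : {w : E → ℝ | ∀ e, 0 < w e} = Set.univ.pi fun _ => Set.Ioi 0 := by
    ext w; simp
  have hmeas : (volume : Measure (E → ℝ)).restrict {w : E → ℝ | ∀ e, 0 < w e} =
      Measure.pi fun _ : E => (volume : Measure ℝ).restrict (Set.Ioi 0) := by
    rw [hset, volume_pi, Measure.restrict_pi_pi]
  set h : E → ℝ → ℝ := fun e t => Real.exp (-(t * b e)) * t ^ (a e - 1) / Real.Gamma (a e) with hh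
  set k : Finset E → E → ℝ → ℝ := fun S e t => (if e ∈ S then t else 1 - t) * h e t with hk
  have hexp : ∀ w, f w * ∏ e, h e (w e) = ∑ S : Finset E,
      f (fun e => if e ∈ S then 1 else 0) * ∏ e, k S e (w e) := by
    intro w
    rw [hf.eq_sum w, Finset.sum_mul]
    refine Finset.sum_congr rfl fun S _ => ?_
    simp only [hk]
    rw [mul_assoc, ← Finset.prod_mul_distrib]
  have hkint : ∀ S e, IntegrableOn (k S e) (Set.Ioi 0) ∧
      ∫ t in Set.Ioi (0 : ℝ), k S e t =
        (if e ∈ S then a e / b e else 1 - a e / b e) * b e ^ (-a e) := by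
    intro S e
    obtain ⟨i1, v1⟩ := integrableOn_gamma (ha e) (hb e)
    obtain ⟨i2, v2⟩ := integrableOn_mul_gamma (ha e) (hb e)
    simp only [hk]
    split_ifs with he
    · exact ⟨i2, by rw [v2]; ring⟩
    · simp only [sub_mul, one_mul]
      refine ⟨i1.sub i2, ?_⟩
      rw [integral_sub i1 i2, v1, v2]
      ring
  have hprodint : ∀ S : Finset E, Integrable (fun w : E → ℝ => f (fun e => if e ∈ S then 1 else 0) *
      ∏ e, k S e (w e)) (Measure.pi fun _ : E => (volume : Measure ℝ).restrict (Set.Ioi 0)) :=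
    fun S => (Integrable.fintype_prod fun e => (hkint S e).1).const_mul _
  have hint : Integrable (fun w : E → ℝ => f w * ∏ e, h e (w e))
      (Measure.pi fun _ : E => (volume : Measure ℝ).restrict (Set.Ioi 0)) := by
    simp only [hexp]
    exact integrable_finsetSum _ fun S _ => hprodint S
  have hval : ∫ w : E → ℝ, f w * ∏ e, h e (w e)
      ∂(Measure.pi fun _ : E => (volume : Measure ℝ).restrict (Set.Ioi 0)) =
      f (fun e => a e / b e) * ∏ e, b e ^ (-a e) := by
    simp only [hexp]
    rw [integral_finsetSum _ fun S _ => hprodint S, hf.eq_sum, Finset.sum_mul]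
    refine Finset.sum_congr rfl fun S _ => ?_
    rw [integral_const_mul, integral_fintype_prod_eq_prod, mul_assoc, ← Finset.prod_mul_distrib]
    congr 1
    exact Finset.prod_congr rfl fun e _ => (hkint S e).2
  rw [hmeas, ← hval, ofReal_integral_eq_lintegral_ofReal hint]
  rw [← hmeas]
  filter_upwards [ae_restrict_mem (by rw [hset]; exact MeasurableSet.univ_pi fun _ =>
    measurableSet_Ioi)] with w hw
  have hw' : ∀ e, 0 < w e := hw
  refine mul_nonneg (h0 w fun e => (hw' e).le) (Finset.prod_nonneg fun e _ => ?_)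
  have := Real.Gamma_pos_of_pos (ha e)
  have := hw' e
  positivity

end Gamma

/-! ### The determinant as a function of the conductances -/

section Determinant

/-- The determinant equals that of a bordered matrix in which t occurs in a single row. No
invertibility of R is needed. -/
theorem det_add_smul_vecMulVec_affine {α : Type*} [Fintype α] [DecidableEq α] (R : Matrix α α ℝ)
    (v : α → ℝ) : ∃ β γ : ℝ, ∀ t : ℝ, (R + t • vecMulVec v v).det = β + γ * t := by
  set N : ℝ → Matrix (α ⊕ Unit) (α ⊕ Unit) ℝ := fun t =>
    fromBlocks R (-replicateCol Unit v) (t • replicateRow Unit v) 1 with hN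
  have h1 : ∀ t, (R + t • vecMulVec v v).det = (N t).det := by
    intro t
    rw [hN]
    simp only
    rw [det_fromBlocks_one₂₂]
    congr 1
    ext i j
    simp [vecMulVec_apply, mul_apply]
  set r0 : α ⊕ Unit → ℝ := Sum.elim 0 1
  set r1 : α ⊕ Unit → ℝ := Sum.elim v 0
  have h2 : ∀ t, N t = (N 0).updateRow (Sum.inr ()) (r0 + t • r1) := by
    intro t
    ext i j
    rcases i with i | i
    · rw [updateRow_ne (by simp)]
      rcases j with j | j <;> rfl
    · rw [updateRow_self]
      rcases j with j | j <;> simp [hN, r0, r1]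
  refine ⟨((N 0).updateRow (Sum.inr ()) r0).det, ((N 0).updateRow (Sum.inr ()) r1).det, fun t => ?_⟩
  rw [h1, h2, det_updateRow_add, det_updateRow_smul]
  ring

variable {V E : Type*} [Fintype V] [DecidableEq V] [Fintype E]

theorem posSemidef_reducedLaplacian (o : V) (p q : E → V) {c : E → ℝ} (hc : ∀ e, 0 ≤ c e) :
    (reducedLaplacian o p q c).PosSemidef := by
  refine posSemidef_sum _ fun e _ => PosSemidef.smul ?_ (hc e)
  have := posSemidef_vecMulVec_self_star (dipole o (p e) (q e))
  rwa [star_trivial] at this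

theorem det_reducedLaplacian_nonneg (o : V) (p q : E → V) {c : E → ℝ} (hc : ∀ e, 0 ≤ c e) :
    0 ≤ (reducedLaplacian o p q c).det :=
  (posSemidef_reducedLaplacian o p q hc).det_nonneg

theorem isMultiaffine_det_reducedLaplacian [DecidableEq E] (o : V) (p q : E → V) :
    IsMultiaffine fun c => (reducedLaplacian o p q c).det := by
  intro c e
  obtain ⟨β, γ, h⟩ := det_add_smul_vecMulVec_affine
    (∑ x ∈ Finset.univ.erase e, c x • vecMulVec (dipole o (p x) (q x)) (dipole o (p x) (q x)))
    (dipole o (p e) (q e))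
  refine ⟨β, γ, fun t => ?_⟩
  simp only [← h, reducedLaplacian]
  rw [← Finset.sum_erase_add _ _ (Finset.mem_univ e)]
  congr 2
  · refine Finset.sum_congr rfl fun x hx => ?_
    rw [Function.update_of_ne (Finset.ne_of_mem_erase hx)]
  · rw [Function.update_self]

theorem det_reducedLaplacian_mono (o : V) (p q : E → V) {c c' : E → ℝ} (hc : ∀ e, 0 ≤ c e)
    (hcc : ∀ e, c e ≤ c' e) :
    (reducedLaplacian o p q c).det ≤ (reducedLaplacian o p q c').det := by
  classical
  exact (isMultiaffine_det_reducedLaplacian o p q).le_of_le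
    (fun c hc => det_reducedLaplacian_nonneg o p q hc) hc hcc

theorem reducedLaplacian_smul (o : V) (p q : E → V) (t : ℝ) (c : E → ℝ) :
    reducedLaplacian o p q (fun e => t * c e) = t • reducedLaplacian o p q c := by
  simp only [reducedLaplacian, Finset.smul_sum, smul_smul]

end Determinant

/-! ### The marginal density of (U,S) and its total mass -/

section Density

variable {V E : Type*} [Fintype V] [DecidableEq V] [Fintype E]

theorem one_le_B (u s : V → ℝ) (x y : V) : 1 ≤ B u s x y := by
  have := Real.one_le_cosh (u x - u y)
  have : 0 ≤ Real.exp (u x + u y) * (s x - s y) ^ 2 / 2 := by positivity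
  unfold B
  linarith

theorem B_pos (u s : V → ℝ) (x y : V) : 0 < B u s x y :=
  zero_lt_one.trans_le (one_le_B u s x y)

/-- The density of `(W, U, S)` for a multigraph. -/
def weightedDensity (o : V) (p q : E → V) (a w : E → ℝ) (u s : V → ℝ) : ℝ :=
  1 / (2 * Real.pi) ^ (Fintype.card V - 1) * Real.exp (-∑ j, u j) *
    Real.exp (-∑ e, w e * (B u s (p e) (q e) - 1)) *
    (reducedLaplacian o p q fun e => w e * Real.exp (u (p e) + u (q e))).det *
    ∏ e, Real.exp (-w e) * w e ^ (a e - 1) / Real.Gamma (a e)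

/-- The density of `(U, S)` for a multigraph. -/
def marginalDensity (o : V) (p q : E → V) (a : E → ℝ) (u s : V → ℝ) : ℝ :=
  1 / (2 * Real.pi) ^ (Fintype.card V - 1) * Real.exp (-∑ j, u j) *
    ((reducedLaplacian o p q fun e =>
      a e / B u s (p e) (q e) * Real.exp (u (p e) + u (q e))).det *
      ∏ e, B u s (p e) (q e) ^ (-a e))

/-- The factors e^{-w_e(B_e-1)} and e^{-w_e} combine to e^{-w_e B_e}: the weights are averaged
against Gamma densities of rate B_e, which puts a_e / B_e into the determinant. -/
theorem lintegral_weightedDensity (o : V) (p q : E → V) {a : E → ℝ} (ha : ∀ e, 0 < a e)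
    (u s : V → ℝ) :
    ∫⁻ w in {w : E → ℝ | ∀ e, 0 < w e}, ENNReal.ofReal (weightedDensity o p q a w u s) =
      ENNReal.ofReal (marginalDensity o p q a u s) := by
  classical
  have hf : IsMultiaffine fun w : E → ℝ =>
      (reducedLaplacian o p q fun e => w e * Real.exp (u (p e) + u (q e))).det :=
    (isMultiaffine_det_reducedLaplacian o p q).comp_mul fun e => Real.exp (u (p e) + u (q e))
  have h0 : ∀ c : E → ℝ, (∀ e, 0 ≤ c e) →
      0 ≤ (reducedLaplacian o p q fun e => c e * Real.exp (u (p e) + u (q e))).det := fun c hc =>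
    det_reducedLaplacian_nonneg o p q fun e => mul_nonneg (hc e) (Real.exp_pos _).le
  have key := lintegral_multiaffine_gamma hf h0 ha fun e => B_pos u s (p e) (q e)
  have hc : 0 ≤ 1 / (2 * Real.pi) ^ (Fintype.card V - 1) * Real.exp (-∑ j, u j) := by positivity
  rw [marginalDensity, ENNReal.ofReal_mul hc, ← key, ← lintegral_const_mul' _ _ ENNReal.ofReal_ne_top]
  refine lintegral_congr fun w => ?_
  rw [← ENNReal.ofReal_mul hc, weightedDensity]
  congr 1
  have h1 : Real.exp (-∑ e, w e * (B u s (p e) (q e) - 1)) *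
      ∏ e, Real.exp (-w e) * w e ^ (a e - 1) / Real.Gamma (a e) =
      ∏ e, Real.exp (-(w e * B u s (p e) (q e))) * w e ^ (a e - 1) / Real.Gamma (a e) := by
    rw [← Finset.sum_neg_distrib, Real.exp_sum, ← Finset.prod_mul_distrib]
    refine Finset.prod_congr rfl fun e _ => ?_
    rw [← mul_div_assoc, ← mul_assoc, ← Real.exp_add]
    congr 3
    ring
  rw [← h1]
  ring

theorem measurable_weightedDensity (o : V) (p q : E → V) (a : E → ℝ) :
    Measurable fun z : (E → ℝ) × H0 o × H0 o =>
      weightedDensity o p q a z.1 z.2.1.toFun z.2.2.toFun := by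
  have hu : ∀ k, Continuous fun z : (E → ℝ) × H0 o × H0 o => z.2.1.toFun k := fun k =>
    (continuous_toFun (o := o) k).comp (continuous_fst.comp continuous_snd)
  have hB : ∀ x y, Continuous fun z : (E → ℝ) × H0 o × H0 o => B z.2.1.toFun z.2.2.toFun x y :=
    fun x y => (continuous_B (o := o) x y).comp continuous_snd
  have hdet : Continuous fun z : (E → ℝ) × H0 o × H0 o =>
      (reducedLaplacian o p q fun e =>
        z.1 e * Real.exp (z.2.1.toFun (p e) + z.2.1.toFun (q e))).det := by
    refine (continuous_det_reducedLaplacian o p q).comp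
      (f := fun z : (E → ℝ) × H0 o × H0 o => fun e =>
        z.1 e * Real.exp (z.2.1.toFun (p e) + z.2.1.toFun (q e))) ?_
    fun_prop
  unfold weightedDensity
  have h1 : Continuous fun z : (E → ℝ) × H0 o × H0 o =>
      1 / (2 * Real.pi) ^ (Fintype.card V - 1) * Real.exp (-∑ j, z.2.1.toFun j) *
      Real.exp (-∑ e, z.1 e * (B z.2.1.toFun z.2.2.toFun (p e) (q e) - 1)) := by
    fun_prop
  refine (h1.measurable.mul hdet.measurable).mul (Finset.measurable_prod _ fun e _ => ?_)
  fun_prop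

theorem measurable_marginalDensity (o : V) (p q : E → V) (a : E → ℝ) :
    Measurable fun z : H0 o × H0 o => marginalDensity o p q a z.1.toFun z.2.toFun := by
  have hu : ∀ k, Continuous fun z : H0 o × H0 o => z.1.toFun k := fun k =>
    (continuous_toFun (o := o) k).comp continuous_fst
  have hB := fun x y => continuous_B (o := o) x y
  have hB0 : ∀ (x y : V) (z : H0 o × H0 o), B z.1.toFun z.2.toFun x y ≠ 0 :=
    fun x y z => (B_pos _ _ x y).ne'
  have hdet : Continuous fun z : H0 o × H0 o =>
      (reducedLaplacian o p q fun e => a e / B z.1.toFun z.2.toFun (p e) (q e) *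
        Real.exp (z.1.toFun (p e) + z.1.toFun (q e))).det := by
    refine (continuous_det_reducedLaplacian o p q).comp
      (f := fun z : H0 o × H0 o => fun e => a e / B z.1.toFun z.2.toFun (p e) (q e) *
        Real.exp (z.1.toFun (p e) + z.1.toFun (q e))) ?_
    refine continuous_pi fun e => (continuous_const.div (hB _ _) (hB0 _ _)).mul ?_
    fun_prop
  unfold marginalDensity
  have h1 : Continuous fun z : H0 o × H0 o =>
      1 / (2 * Real.pi) ^ (Fintype.card V - 1) * Real.exp (-∑ j, z.1.toFun j) := by
    fun_prop
  refine h1.measurable.mul (hdet.measurable.mul (Finset.measurable_prod _ fun e _ => ?_))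
  have := (hB (p e) (q e)).measurable
  fun_prop

/-- The law of `(U, S)` on a connected multigraph has total mass one. -/
theorem lintegral_marginalDensity {p q : E → V} (hconn : IsConnectedMultigraph p q) {a : E → ℝ}
    (ha : ∀ e, 0 < a e) (o : V) :
    ∫⁻ z : H0 o × H0 o, ENNReal.ofReal (marginalDensity o p q a z.1.toFun z.2.toFun) = 1 := by
  classical
  -- Tonelli: integrating (u,s) first, at fixed w, leaves only the product of the Gamma densities.
  have hm := (measurable_weightedDensity o p q a).ennreal_ofReal
  have hswap := lintegral_lintegral_swap (μ := volume.restrict {w : E → ℝ | ∀ e, 0 < w e})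
    (ν := (volume : Measure (H0 o × H0 o)))
    (f := fun w z => ENNReal.ofReal (weightedDensity o p q a w z.1.toFun z.2.toFun))
    hm.aemeasurable
  simp only [lintegral_weightedDensity o p q ha] at hswap
  rw [← hswap]
  have hset : MeasurableSet {w : E → ℝ | ∀ e, 0 < w e} := by
    have : {w : E → ℝ | ∀ e, 0 < w e} = Set.univ.pi fun _ => Set.Ioi 0 := by ext w; simp
    rw [this]
    exact MeasurableSet.univ_pi fun _ => measurableSet_Ioi
  have hone := lintegral_multiaffine_gamma (E := E) (f := fun _ => 1)
    (fun c e => ⟨1, 0, fun t => by simp⟩) (fun _ _ => zero_le_one) (b := fun _ => 1) ha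
    fun _ => one_pos
  simp only [Real.one_rpow, Finset.prod_const_one, mul_one, one_mul, ENNReal.ofReal_one] at hone
  rw [← hone]
  refine setLIntegral_congr_fun hset fun w hw => ?_
  have hw' : ∀ e, 0 < w e := hw
  have hg : 0 ≤ ∏ e, Real.exp (-w e) * w e ^ (a e - 1) / Real.Gamma (a e) := by
    refine Finset.prod_nonneg fun e _ => ?_
    have := Real.Gamma_pos_of_pos (ha e)
    have := hw' e
    positivity
  set C := (2 * Real.pi) ^ (Fintype.card V - 1) with hC
  have hC0 : 0 < C := by positivity
  set g := ∏ e, Real.exp (-w e) * w e ^ (a e - 1) / Real.Gamma (a e) with hgdef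
  have h1 : ∀ z : H0 o × H0 o, ENNReal.ofReal (weightedDensity o p q a w z.1.toFun z.2.toFun) =
      ENNReal.ofReal (g / C) * ENNReal.ofReal (Real.exp (-∑ j, z.1.toFun j) *
        Real.exp (-∑ e, w e * (B z.1.toFun z.2.toFun (p e) (q e) - 1)) *
        (reducedLaplacian o p q
          (fun e => w e * Real.exp (z.1.toFun (p e) + z.1.toFun (q e)))).det) := by
    intro z
    rw [← ENNReal.ofReal_mul (by positivity), weightedDensity]
    congr 1
    rw [← hgdef, ← hC]
    field_simp
  simp only [h1]
  rw [lintegral_const_mul' _ _ ENNReal.ofReal_ne_top, lintegral_fixed_weights hconn hw' o,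
    ← ENNReal.ofReal_mul (by positivity), ← hC, div_mul_cancel₀ _ hC0.ne']

end Density

/-! ### Simple graphs as multigraphs -/

section Graph

variable {V : Type*} (G : SimpleGraph V)

/-- One end of an edge. -/
def edgeFst (e : G.edgeSet) : V := (Quot.out e.1).1

/-- The other end of an edge. -/
def edgeSnd (e : G.edgeSet) : V := (Quot.out e.1).2

theorem mk_edgeFst_edgeSnd (e : G.edgeSet) : s(edgeFst G e, edgeSnd G e) = e.1 :=
  Quot.out_eq e.1

theorem adj_edgeFst_edgeSnd (e : G.edgeSet) : G.Adj (edgeFst G e) (edgeSnd G e) := by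
  have h := e.2
  rwa [← mk_edgeFst_edgeSnd, SimpleGraph.mem_edgeSet] at h

theorem edgeB_eq (u s : V → ℝ) (e : G.edgeSet) :
    edgeB u s e = B u s (edgeFst G e) (edgeSnd G e) := by
  rw [← mk_edgeFst_edgeSnd]
  rfl

variable [Fintype V] [DecidableEq V] [DecidableRel G.Adj]

theorem totalWeight_eq_pairWeight (w : G.edgeSet → ℝ) (i j : V) :
    totalWeight (edgeFst G) (edgeSnd G) w i j = pairWeight G w i j := by
  have hterm : ∀ e : G.edgeSet,
      (if i = edgeFst G e then (1 : ℝ) else 0) * (if j = edgeSnd G e then 1 else 0) +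
        (if i = edgeSnd G e then 1 else 0) * (if j = edgeFst G e then 1 else 0) =
      if s(i, j) = e.1 then 1 else 0 := by
    intro e
    have hne := (adj_edgeFst_edgeSnd G e).ne
    rw [← mk_edgeFst_edgeSnd]
    simp only [Sym2.eq_iff]
    by_cases h1 : i = edgeFst G e <;> by_cases h2 : j = edgeSnd G e <;>
      by_cases h3 : i = edgeSnd G e <;> by_cases h4 : j = edgeFst G e <;>
      simp [h1, h2, h3, h4] <;> grind
  unfold totalWeight pairWeight
  simp only [hterm]
  split_ifs with h
  · rw [Finset.sum_eq_single ⟨s(i, j), h⟩]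
    · simp
    · intro e _ he
      rw [if_neg fun h' => he (Subtype.ext h'.symm), mul_zero]
    · simp
  · refine Finset.sum_eq_zero fun e _ => ?_
    rw [if_neg, mul_zero]
    intro h'
    have := e.2
    rw [← h'] at this
    exact h this

theorem diagMinor_laplacian (o : V) (w : G.edgeSet → ℝ) (u : H0 o) :
    diagMinor (laplacian fun i j => pairWeight G w i j * Real.exp (u.toFun i + u.toFun j)) o =
      (reducedLaplacian o (edgeFst G) (edgeSnd G) fun e =>
        w e * Real.exp (u.toFun (edgeFst G e) + u.toFun (edgeSnd G e))).det := by
  rw [reducedLaplacian_eq_killedLaplacian, diagMinor]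
  congr 1
  ext i j
  have hself : pairWeight G w i i = 0 := by simp [pairWeight]
  rw [submatrix_apply, laplacian, of_apply, killedLaplacian, Matrix.sub_apply, of_apply,
    diagonal_apply]
  simp only [totalWeight_eq_pairWeight, of_apply, Subtype.ext_iff]
  split_ifs with hij
  · rw [sum_eq_root_add o, ← hij, hself]
    simp
    ring
  · simp

theorem jointDensity_eq (o : V) (a w : G.edgeSet → ℝ) (u s : H0 o) :
    jointDensity G o a w u.toFun s.toFun =
      weightedDensity o (edgeFst G) (edgeSnd G) a w u.toFun s.toFun := by
  unfold jointDensity weightedDensity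
  rw [diagMinor_laplacian]
  simp only [edgeB_eq]

theorem lawUS_eq_withDensity (o : V) {a : G.edgeSet → ℝ} (ha : ∀ e, 0 < a e) :
    lawUS G o a = volume.withDensity fun z : H0 o × H0 o =>
      ENNReal.ofReal (marginalDensity o (edgeFst G) (edgeSnd G) a z.1.toFun z.2.toFun) := by
  have hrestrict : (volume : Measure ((G.edgeSet → ℝ) × H0 o × H0 o)).restrict
      {z | ∀ e, 0 < z.1 e} =
      (volume.restrict {w : G.edgeSet → ℝ | ∀ e, 0 < w e}).prod volume := by
    have h := Measure.prod_restrict (μ := (volume : Measure (G.edgeSet → ℝ)))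
      (ν := (volume : Measure (H0 o × H0 o))) {w : G.edgeSet → ℝ | ∀ e, 0 < w e} Set.univ
    rw [Measure.restrict_univ] at h
    rw [h, Measure.volume_eq_prod]
    congr 1
    ext z
    simp
  have hm := (measurable_weightedDensity o (edgeFst G) (edgeSnd G) a).ennreal_ofReal
  ext A hA
  rw [lawUS, Measure.map_apply measurable_snd hA, jointLaw, hrestrict,
    withDensity_apply _ (measurable_snd hA), withDensity_apply _ hA]
  simp only [jointDensity_eq]
  rw [← lintegral_indicator (measurable_snd hA), ← lintegral_indicator hA,
    lintegral_prod_symm _ (hm.indicator (measurable_snd hA)).aemeasurable]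
  refine lintegral_congr fun z => ?_
  by_cases hz : z ∈ A
  · rw [Set.indicator_of_mem hz, ← lintegral_weightedDensity o _ _ ha]
    refine lintegral_congr fun w => ?_
    rw [Set.indicator_of_mem (by exact hz)]
  · rw [Set.indicator_of_notMem hz]
    refine (lintegral_congr fun w => ?_).trans lintegral_zero
    rw [Set.indicator_of_notMem (by exact hz)]

theorem isConnectedMultigraph_of_preconnected (hG : G.Preconnected) :
    IsConnectedMultigraph (edgeFst G) (edgeSnd G) := by
  intro S hS hedge
  obtain ⟨x, hx⟩ := hS
  have hstep : ∀ i j, G.Adj i j → i ∈ S → j ∈ S := by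
    intro i j hij hi
    have h1 := hedge ⟨s(i, j), hij⟩
    have h2 := mk_edgeFst_edgeSnd G ⟨s(i, j), hij⟩
    rcases Sym2.eq_iff.1 h2 with ⟨h3, h4⟩ | ⟨h3, h4⟩
    · rw [h3, h4] at h1; exact h1.1 hi
    · rw [h3, h4] at h1; exact h1.2 hi
  refine Set.eq_univ_of_forall fun y => ?_
  obtain ⟨p⟩ := hG x y
  induction p with
  | nil => exact hx
  | cons h _ ih => exact ih (hstep _ _ h hx)

end Graph

/-! ### Effective resistance and the addition of an edge -/

section Resistance

variable {V : Type*} [Fintype V] [DecidableEq V] (G : SimpleGraph V) [DecidableRel G.Adj]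

theorem IsUnitFlow.sum_mul_sub {G : SimpleGraph V} {x y : V} {θ : V → V → ℝ}
    (hθ : IsUnitFlow G x y θ) (F : V → ℝ) :
    ∑ i, ∑ j, θ i j * (F i - F j) = 2 * (F x - F y) := by
  have h1 : ∑ i, ∑ j, θ i j * F i = F x - F y := by
    simp only [← Finset.sum_mul, hθ.divergence, sub_mul, ite_mul, one_mul, zero_mul,
      Finset.sum_sub_distrib, Finset.sum_ite_eq', Finset.mem_univ, if_true]
  have h2 : ∑ i, ∑ j, θ i j * F j = -(F x - F y) := by
    rw [Finset.sum_comm, ← h1, ← Finset.sum_neg_distrib]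
    refine Finset.sum_congr rfl fun i _ => ?_
    rw [← Finset.sum_neg_distrib]
    refine Finset.sum_congr rfl fun j _ => ?_
    rw [hθ.antisymm]
    ring
  simp only [mul_sub, Finset.sum_sub_distrib]
  rw [h1, h2]
  ring

/-- Thomson's principle: the effective resistance in terms of the Green function. -/
theorem effResistance_eq (hG : G.Preconnected) (o : V) {k : G.edgeSet → ℝ} (hk : ∀ e, 0 < k e)
    {c : V → V → ℝ} (hc : ∀ i j, G.Adj i j → c i j = pairWeight G k i j) (x y : V) :
    effResistance G c x y = dipole o x y ⬝ᵥ
      (reducedLaplacian o (edgeFst G) (edgeSnd G) k)⁻¹ *ᵥ dipole o x y := by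
  have hpd := posDef_reducedLaplacian (isConnectedMultigraph_of_preconnected G hG) hk o
  set L := reducedLaplacian o (edgeFst G) (edgeSnd G) k with hL
  set f : H0 o := L⁻¹ *ᵥ dipole o x y with hf
  set F := f.toFun with hF
  have hLf : L *ᵥ f = dipole o x y := mulVec_inv_mulVec hpd.isUnit _
  have hpw : ∀ i j, G.Adj i j → 0 < pairWeight G k i j := fun i j h => by
    rw [pairWeight, dif_pos h]; exact hk _
  have hpw0 : ∀ i j, ¬ G.Adj i j → pairWeight G k i j = 0 := fun i j h => by
    rw [pairWeight, dif_neg h]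
  have hcomm : ∀ i j, pairWeight G k i j = pairWeight G k j i := fun i j => by
    rw [← totalWeight_eq_pairWeight, totalWeight_comm, totalWeight_eq_pairWeight]
  have hrow : ∀ v, ∑ j, pairWeight G k v j * (F v - F j) =
      ∑ e, k e * (F (edgeFst G e) - F (edgeSnd G e)) *
        ((if v = edgeFst G e then 1 else 0) - (if v = edgeSnd G e then 1 else 0)) := by
    intro v
    simp only [← totalWeight_eq_pairWeight]
    rw [sum_totalWeight_mul]
    refine Finset.sum_congr rfl fun e _ => ?_
    by_cases h1 : v = edgeFst G e <;> by_cases h2 : v = edgeSnd G e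
    · rw [if_pos h1, if_pos h2, ← h1, ← h2]; ring
    · rw [if_pos h1, if_neg h2, ← h1]; ring
    · rw [if_neg h1, if_pos h2, ← h2]; ring
    · rw [if_neg h1, if_neg h2]; ring
  have hdiv' : ∀ v, v ≠ o → ∑ j, pairWeight G k v j * (F v - F j) =
      (if v = x then 1 else 0) - (if v = y then 1 else 0) := by
    intro v hv
    have h := congrFun hLf ⟨v, hv⟩
    rw [hL, reducedLaplacian_mulVec, Finset.sum_apply] at h
    rw [hrow]
    exact h
  -- The reduced system omits the equation at o. It follows from the others, since both sides sum to
  -- zero over all vertices.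
  have hdiv : ∀ v, ∑ j, pairWeight G k v j * (F v - F j) =
      (if v = x then 1 else 0) - (if v = y then 1 else 0) := by
    intro v
    by_cases hv : v = o
    · subst hv
      have h1 : ∑ v, ∑ j, pairWeight G k v j * (F v - F j) = 0 := by
        have h2 : ∑ v, ∑ j, pairWeight G k v j * (F v - F j) =
            -∑ v, ∑ j, pairWeight G k v j * (F v - F j) := by
          conv_lhs => rw [Finset.sum_comm]
          rw [← Finset.sum_neg_distrib]
          refine Finset.sum_congr rfl fun i _ => ?_
          rw [← Finset.sum_neg_distrib]
          refine Finset.sum_congr rfl fun j _ => ?_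
          rw [hcomm]
          ring
        linarith
      have h3 : ∑ i : V, ((if i = x then (1 : ℝ) else 0) - (if i = y then 1 else 0)) = 0 := by
        simp
      rw [sum_eq_root_add v] at h1 h3
      have h5 : ∑ i : {k : V // k ≠ v}, ∑ j, pairWeight G k i j * (F i - F j) =
          ∑ i : {k : V // k ≠ v}, ((if i.1 = x then 1 else 0) - (if i.1 = y then 1 else 0)) :=
        Finset.sum_congr rfl fun i _ => hdiv' i.1 i.2
      rw [h5] at h1
      linarith
    · exact hdiv' v hv
  set θ : V → V → ℝ := fun i j => pairWeight G k i j * (F i - F j) with hθdef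
  have hθ : IsUnitFlow G x y θ :=
    ⟨fun i j => by simp only [hθdef]; rw [hcomm]; ring,
      fun i j h => by simp only [hθdef]; rw [hpw0 i j h, zero_mul], hdiv⟩
  have hR : dipole o x y ⬝ᵥ f = F x - F y := dipole_dotProduct x y f
  rw [hR]
  have hen : energy G c θ = F x - F y := by
    have h := hθ.sum_mul_sub F
    rw [energy, eq_comm, ← mul_right_inj' (two_ne_zero (α := ℝ)), ← h]
    rw [← mul_assoc, mul_one_div_cancel two_ne_zero, one_mul]
    refine Finset.sum_congr rfl fun i _ => Finset.sum_congr rfl fun j _ => ?_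
    split_ifs with hij
    · have := (hpw i j hij).ne'
      simp only [hθdef]
      rw [hc i j hij]
      field_simp
    · simp only [hθdef]
      rw [hpw0 i j hij]
      ring
  refine IsLeast.csInf_eq ⟨⟨θ, hθ, hen⟩, ?_⟩
  rintro _ ⟨φ, hφ, rfl⟩
  have hφ : IsUnitFlow G x y φ := hφ
  have h1 := hφ.sum_mul_sub F
  -- Completing the square: (φ - θ)²/c ≥ 0 with θ = c (F i - F j). The cross term depends only on
  -- the divergence of φ, so the energy of φ is at least that of θ.
  have h2 : ∑ i, ∑ j, (2 * (φ i j * (F i - F j)) - if G.Adj i j then θ i j ^ 2 / c i j else 0) ≤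
      ∑ i, ∑ j, if G.Adj i j then φ i j ^ 2 / c i j else 0 := by
    refine Finset.sum_le_sum fun i _ => Finset.sum_le_sum fun j _ => ?_
    split_ifs with hij
    · have hp := hpw i j hij
      have h3 : φ i j ^ 2 / c i j - (2 * (φ i j * (F i - F j)) - θ i j ^ 2 / c i j) =
          (φ i j - θ i j) ^ 2 / c i j := by
        simp only [hθdef]
        rw [hc i j hij]
        field_simp
        ring
      have h4 : 0 ≤ (φ i j - θ i j) ^ 2 / c i j := by
        rw [hc i j hij]
        positivity
      linarith
    · rw [hφ.support i j hij]
      simp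
  simp only [Finset.sum_sub_distrib, ← Finset.mul_sum] at h2
  rw [h1] at h2
  rw [energy] at hen ⊢
  linarith

theorem effResistance_nonneg {c : V → V → ℝ} (hc : ∀ i j, G.Adj i j → 0 ≤ c i j) (x y : V) :
    0 ≤ effResistance G c x y := by
  refine Real.sInf_nonneg ?_
  rintro _ ⟨θ, -, rfl⟩
  rw [energy]
  refine mul_nonneg (by norm_num) (Finset.sum_nonneg fun i _ => Finset.sum_nonneg fun j _ => ?_)
  split_ifs with h
  · exact div_nonneg (sq_nonneg _) (hc i j h)
  · rfl

/-- The conductances `a_e e^{u_i + u_j} / B_e`. -/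
def edgeCond (a : G.edgeSet → ℝ) (u s : V → ℝ) (e : G.edgeSet) : ℝ :=
  a e / B u s (edgeFst G e) (edgeSnd G e) * Real.exp (u (edgeFst G e) + u (edgeSnd G e))

theorem edgeCond_pos {a : G.edgeSet → ℝ} (ha : ∀ e, 0 < a e) (u s : V → ℝ) (e : G.edgeSet) :
    0 < edgeCond G a u s e :=
  mul_pos (div_pos (ha e) (B_pos _ _ _ _)) (Real.exp_pos _)

theorem D_nonneg {a : G.edgeSet → ℝ} (ha : ∀ e, 0 < a e) (u s : V → ℝ) (x y : V) :
    0 ≤ D G a u s x y := by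
  refine effResistance_nonneg G (fun i j hij => ?_) x y
  rw [cond, pairWeight, dif_pos hij]
  have := ha ⟨s(i, j), hij⟩
  have := B_pos u s x y
  have := B_pos u s i j
  positivity

/-- The conductances c^{xy} are those of `edgeCond` times the constant B_xy e^{-u_x-u_y}, and
resistance scales inversely. -/
theorem D_eq (hG : G.Preconnected) (o : V) {a : G.edgeSet → ℝ} (ha : ∀ e, 0 < a e) (u s : V → ℝ)
    (x y : V) :
    D G a u s x y = Real.exp (u x + u y) / B u s x y * (dipole o x y ⬝ᵥ
      (reducedLaplacian o (edgeFst G) (edgeSnd G) (edgeCond G a u s))⁻¹ *ᵥ dipole o x y) := by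
  set κ := B u s x y / Real.exp (u x + u y) with hκ
  have hκ0 : 0 < κ := div_pos (B_pos _ _ _ _) (Real.exp_pos _)
  have hc : ∀ i j, G.Adj i j → cond G a u s x y i j =
      pairWeight G (fun e => κ * edgeCond G a u s e) i j := by
    intro i j hij
    rw [cond, pairWeight, pairWeight, dif_pos hij, dif_pos hij]
    set e : G.edgeSet := ⟨s(i, j), hij⟩ with he
    have h2 := mk_edgeFst_edgeSnd G e
    have hB : B u s (edgeFst G e) (edgeSnd G e) = B u s i j := by
      rw [← edgeB_eq]; rfl
    have hu : u (edgeFst G e) + u (edgeSnd G e) = u i + u j := by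
      rcases Sym2.eq_iff.1 h2 with ⟨h3, h4⟩ | ⟨h3, h4⟩
      · rw [h3, h4]
      · rw [h3, h4, add_comm]
    rw [edgeCond, hB, hu, hκ, show u i + u j - u x - u y = (u i + u j) - (u x + u y) by ring,
      Real.exp_sub]
    ring
  have hpd := posDef_reducedLaplacian (isConnectedMultigraph_of_preconnected G hG)
    (edgeCond_pos G ha u s) o
  have hinv : (κ • reducedLaplacian o (edgeFst G) (edgeSnd G) (edgeCond G a u s))⁻¹ =
      κ⁻¹ • (reducedLaplacian o (edgeFst G) (edgeSnd G) (edgeCond G a u s))⁻¹ := by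
    refine inv_eq_right_inv ?_
    rw [smul_mul_smul_comm, mul_inv_cancel₀ hκ0.ne', one_smul,
      mul_nonsing_inv _ ((isUnit_iff_isUnit_det _).1 hpd.isUnit)]
  rw [D, effResistance_eq G hG o (fun e => mul_pos hκ0 (edgeCond_pos G ha u s e)) hc,
    reducedLaplacian_smul, hinv, smul_mulVec, dotProduct_smul, smul_eq_mul, hκ, inv_div]

theorem det_add_smul_vecMulVec {α : Type*} [Fintype α] [DecidableEq α] {A : Matrix α α ℝ}
    (hA : IsUnit A) (t : ℝ) (v : α → ℝ) :
    (A + t • vecMulVec v v).det = A.det * (1 + t * (v ⬝ᵥ A⁻¹ *ᵥ v)) := by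
  have h := det_add_replicateCol_mul_replicateRow (ι := Unit) ((isUnit_iff_isUnit_det A).1 hA)
    (t • v) v
  have h1 : replicateCol Unit (t • v) * replicateRow Unit v = t • vecMulVec v v := by
    ext i j
    simp [mul_apply, vecMulVec_apply, mul_assoc]
  rw [h1, replicateRow_mul_mul_replicateCol, mulVec_smul, dotProduct_smul, smul_eq_mul] at h
  rw [h]
  congr 1
  rw [det_unique]
  rfl

variable {E : Type*} [Fintype E]

theorem reducedLaplacian_option (o x y : V) (p q : E → V) (c : Option E → ℝ) :
    reducedLaplacian o (fun e : Option E => e.elim x p) (fun e => e.elim y q) c =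
      reducedLaplacian o p q (fun e => c (some e)) +
        c none • vecMulVec (dipole o x y) (dipole o x y) := by
  rw [reducedLaplacian, Fintype.sum_option, add_comm]
  rfl

/-- The effect on the density of one more edge, from `x` to `y`, of weight `t`. -/
theorem marginalDensity_option (hG : G.Preconnected) (o : V) {a : G.edgeSet → ℝ}
    (ha : ∀ e, 0 < a e) (u s : V → ℝ) (x y : V) (t : ℝ) :
    marginalDensity o (fun e : Option G.edgeSet => e.elim x (edgeFst G))
        (fun e => e.elim y (edgeSnd G)) (fun e => e.elim t a) u s =
      marginalDensity o (edgeFst G) (edgeSnd G) a u s *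
        (B u s x y ^ (-t) * (1 + t * D G a u s x y)) := by
  have hpd := posDef_reducedLaplacian (isConnectedMultigraph_of_preconnected G hG)
    (edgeCond_pos G ha u s) o
  unfold marginalDensity
  rw [reducedLaplacian_option, Fintype.prod_option]
  simp only [Option.elim_none, Option.elim_some]
  change 1 / (2 * Real.pi) ^ (Fintype.card V - 1) * Real.exp (-∑ j, u j) *
    ((reducedLaplacian o (edgeFst G) (edgeSnd G) (edgeCond G a u s) +
      (t / B u s x y * Real.exp (u x + u y)) • vecMulVec (dipole o x y) (dipole o x y)).det * _) =
    1 / (2 * Real.pi) ^ (Fintype.card V - 1) * Real.exp (-∑ j, u j) *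
    ((reducedLaplacian o (edgeFst G) (edgeSnd G) (edgeCond G a u s)).det * _) * _
  rw [det_add_smul_vecMulVec hpd.isUnit, D_eq G hG o ha]
  ring

theorem isConnectedMultigraph_option {p q : E → V} (h : IsConnectedMultigraph p q) (x y : V) :
    IsConnectedMultigraph (fun e : Option E => e.elim x p) (fun e => e.elim y q) :=
  fun S hS he => h S hS fun e => he (some e)

theorem marginalDensity_pos {p q : E → V} (h : IsConnectedMultigraph p q) (o : V) {a : E → ℝ}
    (ha : ∀ e, 0 < a e) (u s : V → ℝ) : 0 < marginalDensity o p q a u s := by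
  refine mul_pos (by positivity) (mul_pos ?_ (Finset.prod_pos fun e _ =>
    Real.rpow_pos_of_pos (B_pos u s _ _) _))
  exact (posDef_reducedLaplacian h
    (fun e => mul_pos (div_pos (ha e) (B_pos _ _ _ _)) (Real.exp_pos _)) o).det_pos

/-- Solving `marginalDensity_option` with t = 1 for D expresses this infimum through a quotient of
measurable densities. -/
theorem measurable_D (hG : G.Preconnected) (o : V) {a : G.edgeSet → ℝ} (ha : ∀ e, 0 < a e)
    (x y : V) : Measurable fun z : H0 o × H0 o => D G a z.1.toFun z.2.toFun x y := by
  have h : (fun z : H0 o × H0 o => D G a z.1.toFun z.2.toFun x y) = fun z =>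
      marginalDensity o (fun e : Option G.edgeSet => e.elim x (edgeFst G))
        (fun e => e.elim y (edgeSnd G)) (fun e => e.elim 1 a) z.1.toFun z.2.toFun /
      marginalDensity o (edgeFst G) (edgeSnd G) a z.1.toFun z.2.toFun *
        B z.1.toFun z.2.toFun x y - 1 := by
    funext z
    have h1 := (marginalDensity_pos (isConnectedMultigraph_of_preconnected G hG) o ha z.1.toFun
      z.2.toFun).ne'
    have h2 := (B_pos z.1.toFun z.2.toFun x y).ne'
    rw [marginalDensity_option G hG o ha, Real.rpow_neg_one]
    field_simp
    ring
  rw [h]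
  exact (((measurable_marginalDensity o _ _ _).div (measurable_marginalDensity o _ _ _)).mul
    (continuous_B x y).measurable).sub_const 1

end Resistance

/-! ### Integrability for exponents below all the weights -/

section Integrability

variable {V : Type*} [Fintype V] [DecidableEq V] (G : SimpleGraph V) [DecidableRel G.Adj]

theorem B_self (u s : V → ℝ) (x : V) : B u s x x = 1 := by
  simp [B]

/-- B is the cosh of the hyperbolic distance between points (s, e^{-u}) of the upper half-plane, and
cosh(α + β) ≤ 2 cosh α cosh β. The proof is the equivalent polynomial inequality, whose defect is a
sum of squares. -/
theorem B_le_two_mul (u s : V → ℝ) (x y z : V) : B u s x z ≤ 2 * (B u s x y * B u s y z) := by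
  have key : ∀ i j, B u s i j = (Real.exp (-u i) ^ 2 + Real.exp (-u j) ^ 2 + (s i - s j) ^ 2) /
      (2 * Real.exp (-u i) * Real.exp (-u j)) := by
    intro i j
    rw [B, Real.cosh_eq, neg_sub, Real.exp_sub, Real.exp_sub, Real.exp_add, Real.exp_neg,
      Real.exp_neg]
    field_simp
    ring
  rw [key, key, key]
  set X := Real.exp (-u x)
  set Y := Real.exp (-u y)
  set Z := Real.exp (-u z)
  have hX : 0 < X := Real.exp_pos _
  have hY : 0 < Y := Real.exp_pos _
  have hZ : 0 < Z := Real.exp_pos _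
  set α := s x - s y with hα
  set β := s y - s z with hβ
  have hαβ : s x - s z = α + β := by rw [hα, hβ]; ring
  rw [hαβ, div_mul_div_comm, mul_div_assoc', div_le_div_iff₀ (by positivity) (by positivity)]
  have h1 : Y ^ 2 * (X ^ 2 + Z ^ 2 + (α + β) ^ 2) ≤
      (X ^ 2 + Y ^ 2 + α ^ 2) * (Y ^ 2 + Z ^ 2 + β ^ 2) := by
    nlinarith [sq_nonneg (Y ^ 2 - α * β), sq_nonneg (X * Z), sq_nonneg (X * β), sq_nonneg (α * Z)]
  have h2 : 0 < 4 * X * Z := by positivity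
  nlinarith [mul_le_mul_of_nonneg_left h1 h2.le]

/-- Iterates `B_le_two_mul`. A path uses each edge at most once, so every B_e has exponent one; this
lets m reach up to the least weight. -/
theorem B_le_prod_of_isPath {x y : V} (w : G.Walk x y) (hw : w.IsPath) :
    ∃ P : Finset G.edgeSet, (∀ e ∈ P, e.1 ∈ w.edges) ∧ ∀ u s : V → ℝ,
      B u s x y ≤ 2 ^ w.length * ∏ e ∈ P, B u s (edgeFst G e) (edgeSnd G e) := by
  induction w with
  | nil => exact ⟨∅, by simp, fun u s => by simp [B_self]⟩
  | @cons x z y h w ih =>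
    rw [SimpleGraph.Walk.cons_isPath_iff] at hw
    obtain ⟨P, hP, hB⟩ := ih hw.1
    set e : G.edgeSet := ⟨s(x, z), h⟩ with he
    have heP : e ∉ P := fun hmem =>
      hw.2 (w.fst_mem_support_of_mem_edges (hP e hmem))
    refine ⟨insert e P, ?_, fun u s => ?_⟩
    · intro e' he'
      rw [SimpleGraph.Walk.edges_cons, List.mem_cons]
      rcases Finset.mem_insert.1 he' with rfl | h'
      · exact Or.inl rfl
      · exact Or.inr (hP e' h')
    · have hBe : B u s (edgeFst G e) (edgeSnd G e) = B u s x z := by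
        rw [← edgeB_eq]; rfl
      rw [Finset.prod_insert heP, hBe, SimpleGraph.Walk.length_cons, pow_succ]
      have h1 := B_le_two_mul u s x z y
      have h2 := mul_le_mul_of_nonneg_left (hB u s) (B_pos u s x z).le
      nlinarith

theorem B_le_prod (hG : G.Preconnected) (x y : V) :
    ∃ K : ℝ, 0 < K ∧ ∃ P : Finset G.edgeSet, ∀ u s : V → ℝ,
      B u s x y ≤ K * ∏ e ∈ P, B u s (edgeFst G e) (edgeSnd G e) := by
  obtain ⟨w, hw⟩ := (hG x y).exists_isPath
  obtain ⟨P, -, hP⟩ := B_le_prod_of_isPath G w hw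
  exact ⟨2 ^ w.length, by positivity, P, hP⟩

/-- The `Option` keeps the index set nonempty when there are no edges. -/
theorem exists_pos_le {ι : Type*} [Finite ι] (g : Option ι → ℝ) (hg : ∀ i, 0 < g i) :
    ∃ δ : ℝ, 0 < δ ∧ ∀ i, δ ≤ g i := by
  obtain ⟨i, hi⟩ := Finite.exists_min g
  exact ⟨g i, hg i, hi⟩

/-- The left side is B_xy^{m+1} times the density with an extra edge of weight 1. Bounding B_xy^{m'}
along a path lowers the path weights by m', slightly above max(m, 0); the surplus ε becomes the
weight of the extra edge. The determinants are compared by monotonicity and homogeneity. -/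
theorem exists_marginalDensity_le (hG : G.Preconnected) (o : V) {a : G.edgeSet → ℝ}
    (ha : ∀ e, 0 < a e) {m : ℝ} (hm : ∀ e, m < a e) (x y : V) :
    ∃ C ε : ℝ, ∃ a' : G.edgeSet → ℝ, 0 < C ∧ 0 < ε ∧ (∀ e, 0 < a' e) ∧ ∀ u s : V → ℝ,
      marginalDensity o (edgeFst G) (edgeSnd G) a u s * (B u s x y ^ m * (1 + D G a u s x y)) ≤
        C * marginalDensity o (fun e : Option G.edgeSet => e.elim x (edgeFst G))
          (fun e => e.elim y (edgeSnd G)) (fun e => e.elim ε a') u s := by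
  obtain ⟨K, hK, P, hP⟩ := B_le_prod G hG x y
  set m₀ := max m 0 with hm₀
  have hm₀a : ∀ e, m₀ < a e := fun e => max_lt (hm e) (ha e)
  obtain ⟨ε, hε, hεa⟩ := exists_pos_le (fun e : Option G.edgeSet => e.elim 1 fun e => (a e - m₀) / 2)
    fun e => by
      cases e with
      | none => exact one_pos
      | some e => exact half_pos (sub_pos.2 (hm₀a e))
  set m' := m₀ + ε with hm'
  have hm'0 : 0 ≤ m' := add_nonneg (le_max_right _ _) hε.le
  have hm'a : ∀ e, m' < a e := fun e => by
    have h1 := hεa (some e)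
    simp only [Option.elim_some] at h1
    linarith [hm₀a e]
  set a' : G.edgeSet → ℝ := fun e => if e ∈ P then a e - m' else a e with ha'def
  have ha' : ∀ e, 0 < a' e := fun e => by
    simp only [ha'def]
    split_ifs
    · exact sub_pos.2 (hm'a e)
    · exact ha e
  -- Scaling the old weights (1, a) by δ puts them below the new ones (ε, a'); the determinant, of
  -- degree n, then costs δ^{-n}.
  obtain ⟨δ, hδ, hδa⟩ := exists_pos_le (fun e : Option G.edgeSet => e.elim ε fun e => a' e / a e)
    fun e => by
      cases e with
      | none => exact hε
      | some e => exact div_pos (ha' e) (ha e)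
  have hδε : δ ≤ ε := hδa none
  have hδa' : ∀ e, δ * a e ≤ a' e := fun e => (le_div_iff₀ (ha e)).1 (hδa (some e))
  set n := Fintype.card {k : V // k ≠ o}
  refine ⟨(δ ^ n)⁻¹ * K ^ m', ε, a', by positivity, hε, ha', fun u s => ?_⟩
  set p' : Option G.edgeSet → V := fun e => e.elim x (edgeFst G)
  set q' : Option G.edgeSet → V := fun e => e.elim y (edgeSnd G)
  have hBpos := B_pos u s x y
  have h1 := marginalDensity_option G hG o ha u s x y 1
  have h2 : marginalDensity o (edgeFst G) (edgeSnd G) a u s *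
      (B u s x y ^ m * (1 + D G a u s x y)) = B u s x y ^ (m + 1) *
        marginalDensity o p' q' (fun e => e.elim 1 a) u s := by
    rw [h1, one_mul, Real.rpow_add hBpos, Real.rpow_one, Real.rpow_neg_one]
    field_simp
  rw [h2]
  unfold marginalDensity
  have hC0 : 0 ≤ 1 / (2 * Real.pi) ^ (Fintype.card V - 1) * Real.exp (-∑ j, u j) := by positivity
  set C0 := 1 / (2 * Real.pi) ^ (Fintype.card V - 1) * Real.exp (-∑ j, u j)
  have hκ : ∀ e, 0 < Real.exp (u (p' e) + u (q' e)) / B u s (p' e) (q' e) := fun e =>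
    div_pos (Real.exp_pos _) (B_pos _ _ _ _)
  have hdet : (reducedLaplacian o p' q' fun e => e.elim 1 a / B u s (p' e) (q' e) *
        Real.exp (u (p' e) + u (q' e))).det ≤ (δ ^ n)⁻¹ *
      (reducedLaplacian o p' q' fun e => e.elim ε a' / B u s (p' e) (q' e) *
        Real.exp (u (p' e) + u (q' e))).det := by
    rw [inv_mul_eq_div, le_div_iff₀' (by positivity), ← det_smul, ← reducedLaplacian_smul]
    refine det_reducedLaplacian_mono o p' q' (fun e => ?_) fun e => ?_
    · have h3 : 0 ≤ (e.elim 1 a : ℝ) := by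
        cases e with
        | none => exact zero_le_one
        | some e => exact (ha e).le
      have := B_pos u s (p' e) (q' e)
      positivity
    · have h3 : δ * e.elim 1 a ≤ e.elim ε a' := by
        cases e with
        | none => simpa using hδε
        | some e => exact hδa' e
      calc δ * (e.elim 1 a / B u s (p' e) (q' e) * Real.exp (u (p' e) + u (q' e)))
          = (δ * e.elim 1 a) * (Real.exp (u (p' e) + u (q' e)) / B u s (p' e) (q' e)) := by ring
        _ ≤ e.elim ε a' * (Real.exp (u (p' e) + u (q' e)) / B u s (p' e) (q' e)) :=
            mul_le_mul_of_nonneg_right h3 (hκ e).le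
        _ = e.elim ε a' / B u s (p' e) (q' e) * Real.exp (u (p' e) + u (q' e)) := by ring
  have hprod : B u s x y ^ (m + 1) * ∏ e, B u s (p' e) (q' e) ^ (-(e.elim 1 a : ℝ)) ≤
      K ^ m' * ∏ e, B u s (p' e) (q' e) ^ (-(e.elim ε a' : ℝ)) := by
    rw [Fintype.prod_option, Fintype.prod_option]
    simp only [p', q', Option.elim_none, Option.elim_some]
    have hB1 : B u s x y ^ m ≤ B u s x y ^ m' * B u s x y ^ (-ε) := by
      rw [← Real.rpow_add hBpos]
      refine Real.rpow_le_rpow_of_exponent_le (one_le_B u s x y) ?_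
      rw [hm', add_neg_cancel_right]
      exact le_max_left _ _
    have hQ : 0 ≤ ∏ e ∈ P, B u s (edgeFst G e) (edgeSnd G e) :=
      Finset.prod_nonneg fun e _ => (B_pos u s _ _).le
    have hB2 : B u s x y ^ m' ≤
        K ^ m' * ∏ e ∈ P, B u s (edgeFst G e) (edgeSnd G e) ^ m' := by
      rw [Real.finsetProd_rpow _ _ fun e _ => (B_pos u s _ _).le, ← Real.mul_rpow hK.le hQ]
      exact Real.rpow_le_rpow hBpos.le (hP u s) hm'0
    have hsplit : (∏ e ∈ P, B u s (edgeFst G e) (edgeSnd G e) ^ m') *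
        ∏ e, B u s (edgeFst G e) (edgeSnd G e) ^ (-a e) =
        ∏ e, B u s (edgeFst G e) (edgeSnd G e) ^ (-a' e) := by
      rw [← Finset.prod_ite_mem_eq, ← Finset.prod_mul_distrib]
      refine Finset.prod_congr rfl fun e _ => ?_
      simp only [ha'def]
      split_ifs
      · rw [← Real.rpow_add (B_pos _ _ _ _)]
        congr 1
        ring
      · rw [one_mul]
    have hR : 0 ≤ ∏ e, B u s (edgeFst G e) (edgeSnd G e) ^ (-a e) :=
      Finset.prod_nonneg fun e _ => Real.rpow_nonneg (B_pos u s _ _).le _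
    have hBε : 0 ≤ B u s x y ^ (-ε) := Real.rpow_nonneg hBpos.le _
    rw [← hsplit, ← mul_assoc, ← Real.rpow_add hBpos, add_neg_cancel_right]
    calc B u s x y ^ m * ∏ e, B u s (edgeFst G e) (edgeSnd G e) ^ (-a e)
        ≤ (B u s x y ^ m' * B u s x y ^ (-ε)) *
          ∏ e, B u s (edgeFst G e) (edgeSnd G e) ^ (-a e) := mul_le_mul_of_nonneg_right hB1 hR
      _ ≤ ((K ^ m' * ∏ e ∈ P, B u s (edgeFst G e) (edgeSnd G e) ^ m') * B u s x y ^ (-ε)) *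
          ∏ e, B u s (edgeFst G e) (edgeSnd G e) ^ (-a e) :=
        mul_le_mul_of_nonneg_right (mul_le_mul_of_nonneg_right hB2 hBε) hR
      _ = _ := by ring
  have hd0 : 0 ≤ (reducedLaplacian o p' q' fun e => e.elim ε a' / B u s (p' e) (q' e) *
        Real.exp (u (p' e) + u (q' e))).det := by
    refine det_reducedLaplacian_nonneg o p' q' fun e => ?_
    have h3 : 0 ≤ (e.elim ε a' : ℝ) := by
      cases e with
      | none => exact hε.le
      | some e => exact (ha' e).le
    have := B_pos u s (p' e) (q' e)
    positivity
  have hB0 : 0 ≤ B u s x y ^ (m + 1) * ∏ e, B u s (p' e) (q' e) ^ (-(e.elim 1 a : ℝ)) :=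
    mul_nonneg (Real.rpow_nonneg hBpos.le _)
      (Finset.prod_nonneg fun e _ => Real.rpow_nonneg (B_pos u s _ _).le _)
  have hfin := mul_le_mul_of_nonneg_left (mul_le_mul hdet hprod hB0 (by positivity)) hC0
  calc _ = _ := by ring
    _ ≤ _ := hfin
    _ = _ := by ring

theorem integrable_rpow_mul_one_add (hG : G.Preconnected) (o : V) {a : G.edgeSet → ℝ}
    (ha : ∀ e, 0 < a e) {m : ℝ} (hm : ∀ e, m < a e) (x y : V) :
    Integrable (fun z : H0 o × H0 o => B z.1.toFun z.2.toFun x y ^ m *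
      (1 + D G a z.1.toFun z.2.toFun x y)) (lawUS G o a) := by
  have hmeas : Measurable fun z : H0 o × H0 o => B z.1.toFun z.2.toFun x y ^ m *
      (1 + D G a z.1.toFun z.2.toFun x y) :=
    ((continuous_B x y).measurable.pow_const m).mul ((measurable_D G hG o ha x y).const_add 1)
  have hnn : ∀ z : H0 o × H0 o, 0 ≤ B z.1.toFun z.2.toFun x y ^ m *
      (1 + D G a z.1.toFun z.2.toFun x y) := fun z =>
    mul_nonneg (Real.rpow_nonneg (B_pos _ _ _ _).le _)
      (add_nonneg zero_le_one (D_nonneg G ha _ _ x y))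
  refine ⟨hmeas.aestronglyMeasurable, ?_⟩
  rw [hasFiniteIntegral_iff_ofReal (ae_of_all _ hnn), lawUS_eq_withDensity G o ha,
    lintegral_withDensity_eq_lintegral_mul _
      (measurable_marginalDensity o _ _ a).ennreal_ofReal hmeas.ennreal_ofReal]
  obtain ⟨C, ε, a', hC, hε, ha', hle⟩ := exists_marginalDensity_le G hG o ha hm x y
  have hconn := isConnectedMultigraph_of_preconnected G hG
  have hone := lintegral_marginalDensity (isConnectedMultigraph_option hconn x y)
    (a := fun e => e.elim ε a') (fun e => by
      cases e with
      | none => exact hε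
      | some e => exact ha' e) o
  set g : H0 o × H0 o → ℝ := fun z => marginalDensity o
    (fun e : Option G.edgeSet => e.elim x (edgeFst G)) (fun e => e.elim y (edgeSnd G))
    (fun e => e.elim ε a') z.1.toFun z.2.toFun
  have hbound : ∀ z : H0 o × H0 o, ((fun z : H0 o × H0 o => ENNReal.ofReal
      (marginalDensity o (edgeFst G) (edgeSnd G) a z.1.toFun z.2.toFun)) * fun z : H0 o × H0 o =>
        ENNReal.ofReal (B z.1.toFun z.2.toFun x y ^ m * (1 + D G a z.1.toFun z.2.toFun x y))) z ≤
      ENNReal.ofReal C * ENNReal.ofReal (g z) := by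
    intro z
    rw [Pi.mul_apply, ← ENNReal.ofReal_mul (marginalDensity_pos hconn o ha _ _).le,
      ← ENNReal.ofReal_mul hC.le]
    exact ENNReal.ofReal_le_ofReal (hle z.1.toFun z.2.toFun)
  refine (lintegral_mono hbound).trans_lt ?_
  rw [lintegral_const_mul' _ _ ENNReal.ofReal_ne_top, hone, mul_one]
  exact ENNReal.ofReal_lt_top

theorem integrable_rpow (hG : G.Preconnected) (o : V) {a : G.edgeSet → ℝ}
    (ha : ∀ e, 0 < a e) {m : ℝ} (hm : ∀ e, m < a e) (x y : V) :
    Integrable (fun z : H0 o × H0 o => B z.1.toFun z.2.toFun x y ^ m) (lawUS G o a) := by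
  refine (integrable_rpow_mul_one_add G hG o ha hm x y).mono'
    ((continuous_B x y).measurable.pow_const m).aestronglyMeasurable (ae_of_all _ fun z => ?_)
  have h1 := Real.rpow_nonneg (B_pos z.1.toFun z.2.toFun x y).le m
  have h2 := D_nonneg G ha z.1.toFun z.2.toFun x y
  rw [Real.norm_of_nonneg h1]
  nlinarith

theorem integrable_rpow_mul_D (hG : G.Preconnected) (o : V) {a : G.edgeSet → ℝ}
    (ha : ∀ e, 0 < a e) {m : ℝ} (hm : ∀ e, m < a e) (x y : V) :
    Integrable (fun z : H0 o × H0 o => B z.1.toFun z.2.toFun x y ^ m *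
      D G a z.1.toFun z.2.toFun x y) (lawUS G o a) := by
  refine ((integrable_rpow_mul_one_add G hG o ha hm x y).sub
    (integrable_rpow G hG o ha hm x y)).congr (ae_of_all _ fun z => ?_)
  simp only [Pi.sub_apply]
  ring

end Integrability

/-! ### The Ward identity and its analytic continuation -/

section Ward

variable {V : Type*} [Fintype V] [DecidableEq V] (G : SimpleGraph V) [DecidableRel G.Adj]

/-- Times the density, the integrand is the density of the graph with an extra edge of positive
weight -m, whose mass is one. -/
theorem ward_identity_of_neg (hG : G.Preconnected) (o : V) {a : G.edgeSet → ℝ}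
    (ha : ∀ e, 0 < a e) {m : ℝ} (hm : m < 0) (x y : V) :
    ∫ z : H0 o × H0 o, B z.1.toFun z.2.toFun x y ^ m * (1 - m * D G a z.1.toFun z.2.toFun x y)
      ∂(lawUS G o a) = 1 := by
  have hconn := isConnectedMultigraph_of_preconnected G hG
  have hmeas : Measurable fun z : H0 o × H0 o => B z.1.toFun z.2.toFun x y ^ m *
      (1 - m * D G a z.1.toFun z.2.toFun x y) :=
    ((continuous_B x y).measurable.pow_const m).mul
      (((measurable_D G hG o ha x y).const_mul m).const_sub 1)
  have hnn : ∀ z : H0 o × H0 o, 0 ≤ B z.1.toFun z.2.toFun x y ^ m *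
      (1 - m * D G a z.1.toFun z.2.toFun x y) := fun z => by
    have h1 := D_nonneg G ha z.1.toFun z.2.toFun x y
    have h2 := mul_nonneg (neg_nonneg.2 hm.le) h1
    exact mul_nonneg (Real.rpow_nonneg (B_pos _ _ _ _).le _) (by linarith)
  rw [integral_eq_lintegral_of_nonneg_ae (ae_of_all _ hnn) hmeas.aestronglyMeasurable,
    lawUS_eq_withDensity G o ha, lintegral_withDensity_eq_lintegral_mul _
      (measurable_marginalDensity o _ _ a).ennreal_ofReal hmeas.ennreal_ofReal]
  have hone := lintegral_marginalDensity (isConnectedMultigraph_option hconn x y)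
    (a := fun e => e.elim (-m) a) (fun e => by
      cases e with
      | none => exact neg_pos.2 hm
      | some e => exact ha e) o
  have hpt : ∀ z : H0 o × H0 o, ((fun z : H0 o × H0 o => ENNReal.ofReal
      (marginalDensity o (edgeFst G) (edgeSnd G) a z.1.toFun z.2.toFun)) * fun z : H0 o × H0 o =>
        ENNReal.ofReal (B z.1.toFun z.2.toFun x y ^ m *
          (1 - m * D G a z.1.toFun z.2.toFun x y))) z =
      ENNReal.ofReal (marginalDensity o
        (fun e : Option G.edgeSet => e.elim x (edgeFst G)) (fun e => e.elim y (edgeSnd G))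
        (fun e => e.elim (-m) a) z.1.toFun z.2.toFun) := by
    intro z
    rw [Pi.mul_apply, ← ENNReal.ofReal_mul (marginalDensity_pos hconn o ha _ _).le,
      marginalDensity_option G hG o ha, neg_neg, neg_mul, ← sub_eq_add_neg]
  rw [lintegral_congr hpt, hone, ENNReal.toReal_one]

/-- The Ward identity on a finite connected graph, for every exponent below all the weights. -/
theorem ward_identity (hG : G.Preconnected) (o : V) {a : G.edgeSet → ℝ} (ha : ∀ e, 0 < a e)
    {m : ℝ} (hm : ∀ e, m < a e) (x y : V) :
    Integrable (fun z : H0 o × H0 o => B z.1.toFun z.2.toFun x y ^ m *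
        (1 - m * D G a z.1.toFun z.2.toFun x y)) (lawUS G o a) ∧
      ∫ z : H0 o × H0 o, B z.1.toFun z.2.toFun x y ^ m *
        (1 - m * D G a z.1.toFun z.2.toFun x y) ∂(lawUS G o a) = 1 := by
  set μ := lawUS G o a with hμ
  set U : Set ℝ := ⋂ e, Set.Iio (a e) with hU
  have hmemU : ∀ t, t ∈ U ↔ ∀ e, t < a e := fun t => by simp [hU]
  have hopen : IsOpen U := isOpen_iInter_of_finite fun e => isOpen_Iio
  have hpre : IsPreconnected U := (convex_iInter fun e => convex_Iio (a e)).isPreconnected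
  set X : H0 o × H0 o → ℝ := fun z => Real.log (B z.1.toFun z.2.toFun x y) with hX
  have hexp : ∀ t z, Real.exp (t * X z) = B z.1.toFun z.2.toFun x y ^ t := fun t z => by
    rw [Real.rpow_def_of_pos (B_pos _ _ _ _), mul_comm]
  set R : H0 o × H0 o → ℝ := fun z => D G a z.1.toFun z.2.toFun x y with hR
  have hRm : Measurable R := measurable_D G hG o ha x y
  have hR0 : ∀ z, 0 ≤ R z := fun z => D_nonneg G ha _ _ x y
  -- Tilting by the resistance makes the second term a moment generating function too, hence
  -- analytic in t.
  set ν := μ.withDensity fun z => ENNReal.ofReal (R z) with hν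
  have hi1 : ∀ t ∈ U, Integrable (fun z => Real.exp (t * X z)) μ := fun t ht => by
    simp only [hexp]
    exact integrable_rpow G hG o ha ((hmemU t).1 ht) x y
  have hi2 : ∀ t ∈ U, Integrable (fun z => Real.exp (t * X z) * R z) μ := fun t ht => by
    simp only [hexp]
    exact integrable_rpow_mul_D G hG o ha ((hmemU t).1 ht) x y
  have hi3 : ∀ t ∈ U, Integrable (fun z => Real.exp (t * X z)) ν := fun t ht => by
    rw [hν, integrable_withDensity_iff hRm.ennreal_ofReal (ae_of_all _ fun _ => ENNReal.ofReal_lt_top)]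
    simp only [ENNReal.toReal_ofReal (hR0 _)]
    exact hi2 t ht
  have hs1 : U ⊆ interior (ProbabilityTheory.integrableExpSet X μ) :=
    interior_maximal (fun t ht => hi1 t ht) hopen
  have hs2 : U ⊆ interior (ProbabilityTheory.integrableExpSet X ν) :=
    interior_maximal (fun t ht => hi3 t ht) hopen
  set F : ℝ → ℝ := fun t => ProbabilityTheory.mgf X μ t - t * ProbabilityTheory.mgf X ν t with hF
  have hFan : AnalyticOnNhd ℝ F U :=
    (ProbabilityTheory.analyticOnNhd_mgf.mono hs1).sub
      (analyticOnNhd_id.mul (ProbabilityTheory.analyticOnNhd_mgf.mono hs2))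
  have hFeq : ∀ t ∈ U, ∫ z, B z.1.toFun z.2.toFun x y ^ t * (1 - t * R z) ∂μ = F t := by
    intro t ht
    have h1 : ProbabilityTheory.mgf X ν t = ∫ z, Real.exp (t * X z) * R z ∂μ := by
      rw [ProbabilityTheory.mgf, hν, integral_withDensity_eq_integral_toReal_smul
        hRm.ennreal_ofReal (ae_of_all _ fun _ => ENNReal.ofReal_lt_top)]
      refine integral_congr_ae (ae_of_all _ fun z => ?_)
      simp only [ENNReal.toReal_ofReal (hR0 z), smul_eq_mul]
      ring
    rw [hF]
    simp only
    rw [h1, ProbabilityTheory.mgf, ← integral_const_mul,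
      ← integral_sub (hi1 t ht) ((hi2 t ht).const_mul t)]
    refine integral_congr_ae (ae_of_all _ fun z => ?_)
    simp only [hexp]
    ring
  have hneg : ∀ t < 0, t ∈ U := fun t ht => (hmemU t).2 fun e => ht.trans (ha e)
  have hev : F =ᶠ[nhds (-1)] fun _ => 1 := by
    filter_upwards [Iio_mem_nhds (show (-1 : ℝ) < 0 by norm_num)] with t ht
    rw [← hFeq t (hneg t ht)]
    exact ward_identity_of_neg G hG o ha ht x y
  -- Identity theorem on the half-line U (all of ℝ if there are no edges); any negative base point
  -- would do.
  have hall := hFan.eqOn_of_preconnected_of_eventuallyEq analyticOnNhd_const hpre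
    (hneg (-1) (by norm_num)) hev
  have hmU : m ∈ U := (hmemU m).2 hm
  refine ⟨?_, (hFeq m hmU).trans (hall hmU)⟩
  refine ((hi1 m hmU).sub ((hi2 m hmU).const_mul m)).congr (ae_of_all _ fun z => ?_)
  simp only [Pi.sub_apply, hexp]
  ring

end Ward

/-! ### Connectedness of the box -/

section BoxGraph

/-- Moving a nonzero coordinate one step towards 0 stays in the box and lowers the ℓ¹ norm by one,
so every vertex is joined to the origin. -/
theorem boxGraph_preconnected (d n : ℕ) : (boxGraph d n).Preconnected := by
  have key : ∀ (N : ℕ) (i : Box d n), ∑ k, (i.1 k).natAbs = N →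
      (boxGraph d n).Reachable i (origin d n) := by
    intro N
    induction N with
    | zero =>
      intro i hi
      have : i = origin d n := by
        refine Subtype.ext (funext fun k => ?_)
        have := (Finset.sum_eq_zero_iff.1 hi) k (Finset.mem_univ k)
        simpa [origin] using this
      rw [this]
    | succ N ih =>
      intro i hi
      obtain ⟨k, hk⟩ : ∃ k, i.1 k ≠ 0 := by
        by_contra! hall
        simp [hall] at hi
      have hmem := Finset.mem_Icc.1 i.2
      have hlo := hmem.1 k
      have hhi := hmem.2 k
      simp only at hlo hhi
      set j : Fin d → ℤ := Function.update i.1 k (i.1 k - (i.1 k).sign) with hj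
      have hsign : ((i.1 k).sign = 1 ∧ 0 < i.1 k) ∨ ((i.1 k).sign = -1 ∧ i.1 k < 0) := by
        rcases lt_or_gt_of_ne hk with h | h
        · exact Or.inr ⟨Int.sign_eq_neg_one_of_neg h, h⟩
        · exact Or.inl ⟨Int.sign_eq_one_of_pos h, h⟩
      have hjmem : j ∈ Finset.Icc (fun _ : Fin d => -(n : ℤ)) (fun _ => (n : ℤ)) := by
        rw [Finset.mem_Icc]
        constructor <;> intro l <;> by_cases hl : l = k
        · subst hl
          rw [hj, Function.update_self]
          change -(n : ℤ) ≤ _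
          rcases hsign with ⟨h, h'⟩ | ⟨h, h'⟩ <;> rw [h] <;> omega
        · rw [hj, Function.update_of_ne hl]
          exact hmem.1 l
        · subst hl
          rw [hj, Function.update_self]
          change _ ≤ (n : ℤ)
          rcases hsign with ⟨h, h'⟩ | ⟨h, h'⟩ <;> rw [h] <;> omega
        · rw [hj, Function.update_of_ne hl]
          exact hmem.2 l
      have hadj : (boxGraph d n).Adj i ⟨j, hjmem⟩ := by
        change ∑ l, |i.1 l - j l| = 1
        rw [Finset.sum_eq_single k]
        · rw [hj, Function.update_self]
          rcases hsign with ⟨h, -⟩ | ⟨h, -⟩ <;> simp [h]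
        · intro l _ hl
          rw [hj, Function.update_of_ne hl, sub_self, abs_zero]
        · simp
      refine hadj.reachable.trans (ih ⟨j, hjmem⟩ ?_)
      have h1 := Finset.add_sum_erase Finset.univ (fun l => (i.1 l).natAbs) (Finset.mem_univ k)
      have h2 := Finset.add_sum_erase Finset.univ (fun l => (j l).natAbs) (Finset.mem_univ k)
      have h3 : ∑ l ∈ Finset.univ.erase k, (j l).natAbs =
          ∑ l ∈ Finset.univ.erase k, (i.1 l).natAbs :=
        Finset.sum_congr rfl fun l hl => by
          rw [hj, Function.update_of_ne (Finset.ne_of_mem_erase hl)]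
      have h4 : (j k).natAbs + 1 = (i.1 k).natAbs := by
        rw [hj, Function.update_self]
        omega
      simp only at h1 h2 ⊢
      omega
  exact fun i j => (key _ i rfl).trans (key _ j rfl).symm

end BoxGraph

end

end Ward

theorem mainTheorem5 (d : ℕ) (hd : 3 ≤ d) (n : ℕ)
    (a : (Ward.boxGraph d n).edgeSet → ℝ) (ha : ∀ e, 0 < a e)
    (m : ℝ) (hm : ∀ e, m ≤ a e / 4) (x y : Ward.Box d n) :
    MeasureTheory.Integrable
      (fun p : Ward.H0 (Ward.origin d n) × Ward.H0 (Ward.origin d n) =>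
        Ward.B p.1.toFun p.2.toFun x y ^ m *
          (1 - m * Ward.D (Ward.boxGraph d n) a p.1.toFun p.2.toFun x y))
      (Ward.lawUS (Ward.boxGraph d n) (Ward.origin d n) a) ∧
    ∫ p : Ward.H0 (Ward.origin d n) × Ward.H0 (Ward.origin d n),
        Ward.B p.1.toFun p.2.toFun x y ^ m *
          (1 - m * Ward.D (Ward.boxGraph d n) a p.1.toFun p.2.toFun x y)
      ∂(Ward.lawUS (Ward.boxGraph d n) (Ward.origin d n) a) = 1 :=
  Ward.ward_identity _ (Ward.boxGraph_preconnected d n) _ ha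
    (fun e => by linarith [hm e, ha e]) x y
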